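/- Let $\mathbb{A}$ be a resource theory, i.e. a symmetric strict monoidal category with tensor $\otimes$, unit $I$ and symmetry $\sigma$. **Free cornering.** Let $\mathbb{A}^{\circ\bullet}$ be the free monoid on the polarized objects $A^\circ, A^\bullet$ of $\mathbb{A}$; we write $\otimes$ for concatenation and $I$ for the empty sequence. Let $\ulcorner\mathbb{A}\urcorner$ be the free single-object double category whose cells have top and bottom boundary in the monoid $(\mathbb{A}_0,\otimes,I)$ and left and right boundary in $\mathbb{A}^{\circ\bullet}$, generated by a cell $\ulcorner f\urcorner$ for each arrow $f:A\to B$ of $\mathbb{A}$ (top $A$, bottom $B$, trivial sides) and, for each object $A$, four corners with all unlisted boundaries trivial: (top $A$, right $A^\circ$), (left $A^\circ$, bottom $A$), (right $A^\bullet$, bottom $A$), (top $A$, left $A^\bullet$). Write $\alpha\mid\beta$ for horizontal composition ($\alpha$ to the left of $\beta$) and $\alpha/\beta$ for vertical composition ($\alpha$ above $\beta$). The relations are: $\ulcorner 1_A\urcorner$ is the vertical identity on $A$; for $f:A\to B$ and $g:B\to C$, $\ulcorner gf\urcorner=\ulcorner f\urcorner/\ulcorner g\urcorner$; $\ulcorner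 f\otimes g\urcorner=\ulcorner f\urcorner\mid\ulcorner g\urcorner$; and the yanking equations, namely that in each polarity the horizontal composite of the two corners is the vertical identity on $A$, and their vertical composite is the horizontal identity on $A^\circ$ (resp. $A^\bullet$). For $B\in\mathbb{A}_0$ and $X\in\mathbb{A}^{\circ\bullet}$ the crossing cell $\chi_{B,X}$ has top and bottom $B$ and left and right $X$. It is given by $\chi_{B,I}=1_B$ (the vertical identity), $\chi_{B,X\otimes Y}=\chi_{B,X}/\chi_{B,Y}$, and, writing a corner by its nontrivial boundaries, $$\chi_{B,A^\circ}=(\text{left }A^\circ,\text{bottom }A\mid 1_B)\,/\,\ulcorner\sigma_{A,B}\urcorner\,/\,(1_B\mid\text{top }A,\text{right }A^\circ),$$ $$\chi_{B,A^\bullet}=(1_B\mid\text{right }A^\bullet,\text{bottom }A)\,/\,\ulcorner\sigma_{B,A}\urcorner\,/\,(\text{top }A,\text{left }A^\bullet\mid 1_B).$$ For a cell $\alpha$ with bottom $B$ and right $Y$, and a cell $\alpha'$ with top $A'$ and left $X'$, put $$\alpha\otimes\alpha'=(\alpha\mid\chi_{A',Y})\,/\,(\chi_{B,X'}\mid\alpha').$$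 **The category $\mathsf{S}(\mathbb{A})$.** Let $\langle\mathbb{A}\rangle$ be the reflexive graph with vertices $\mathbb{A}_0$, with the cells of $\ulcorner\mathbb{A}\urcorner$ as edges from top to bottom boundary, and with the vertical identities as trivial edges; regard $\mathbb{A}^{\circ\bullet}$ as a reflexive graph with one vertex and trivial edge $I$. Objects of $\mathsf{S}(\mathbb{A})$ are situated boundaries $(U,\phi_U)$: a reflexive graph $U$ with a morphism $\phi_U:U\to\mathbb{A}^{\circ\bullet}$. A situated transition system $(R,\phi_R):(U,\phi_U)\to(V,\phi_V)$ is a span $U\leftarrow R\to V$ of reflexive graphs with a morphism $\phi_R:R\to\langle\mathbb{A}\rangle$ such that, for each edge $t$ of $R$, the left and right boundaries of $\phi_R(t)$ are the labels under $\phi_U$ and $\phi_V$ of the images of $t$ under the legs. Arrows of $\mathsf{S}(\mathbb{A})$ are such systems modulo the relation $(R,\phi_R)\sim(S,\phi_S)$, which holds if there are an isomorphism of spans $a:R\cong S$ and isomorphisms $\iota_x:\phi_R(x)\cong\phi_S(a(x))$ in $\mathbb{A}$, one for each vertex $x$ of $R$, with $\phi_R(t)/\ulcorner\iota_y\urcorner=\ulcorner\iota_x\urcorner/\phi_S(a(t))$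 for every edge $t:x\to y$ of $R$. Systems are composed by pullback of spans, with $(t,t')$ labelled by $\phi_R(t)\mid\phi_S(t')$; the identity on $(U,\phi_U)$ is the identity span, with each edge $t$ labelled by the horizontal identity cell on $\phi_U(t)$. **Proposition.** $\mathsf{S}(\mathbb{A})$ is a monoidal category, with the following structure. On objects, $(U,\phi_U)\otimes(V,\phi_V)=U\times V$ with $(x,y)\mapsto\phi_U(x)\otimes\phi_V(y)$ on edges; the unit is the one-vertex graph with only the trivial edge. On arrows, $(R,\phi_R)\otimes(S,\phi_S)$ is the product of the two spans, with vertices labelled by $(p,q)\mapsto\phi_R(p)\otimes\phi_S(q)$ and edges by $(t,t')\mapsto\phi_R(t)\otimes\phi_S(t')$. The associators and unitors are represented by the associativity and unit isomorphisms of the product of reflexive graphs: an isomorphism $e:U\cong V$ of reflexive graphs with $\phi_V\circ e=\phi_U$ gives the span $U\xleftarrow{1}U\xrightarrow{e}V$, labelled by the horizontal identity cells on the $\phi_U(t)$. -/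

import Mathlib

open CategoryTheory MonoidalCategory

universe s t v u

/-- A strict monoidal category: associativity and unitality of the tensor product hold on the nose
on objects, and the associators and unitors are the corresponding identities. -/
class StrictMonoidal (C : Type u) [Category.{v} C] [MonoidalCategory C] : Prop where
  tensor_assoc : ∀ a b c : C, (a ⊗ b) ⊗ c = a ⊗ (b ⊗ c)
  unit_tensor : ∀ a : C, 𝟙_ C ⊗ a = a
  tensor_unit : ∀ a : C, a ⊗ 𝟙_ C = a
  associator_hom : ∀ a b c : C, (α_ a b c).hom = eqToHom (tensor_assoc a b c)
  leftUnitor_hom : ∀ a : C, (λ_ a).hom = eqToHom (unit_tensor a)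
  rightUnitor_hom : ∀ a : C, (ρ_ a).hom = eqToHom (tensor_unit a)

/-! ### Exchanges and the free cornering

Throughout, `A` is a resource theory, i.e. a symmetric strict monoidal category. -/

/-- The polarity of a resource in an exchange: `A∘` flows from left to right,
`A•` flows from right to left. -/
inductive Polarity
  | ltr
  | rtl

/-- The free monoid of `A`-valued exchanges, i.e. finite sequences of polarized objects, with
concatenation `++` as operation and the empty sequence as unit. -/
abbrev Exchange (A : Type u) : Type u := List (A × Polarity)

/-- Formal pastings of the generating cells of the free cornering.
`vcomp x y` has `x` above `y`, and `hcomp x y` has `x` to the left of `y`. -/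
inductive RawCell (A : Type u) [Category.{v} A] : Type (max u v)
  /-- the cell of an arrow `f` of `A` -/
  | vert {a b : A} (f : a ⟶ b)
  /-- the corner where `a` enters at the top and leaves through the right boundary -/
  | outRight (a : A)
  /-- the corner where `a` enters through the left boundary and leaves at the bottom -/
  | inLeft (a : A)
  /-- the corner where `a` enters at the top and leaves through the left boundary -/
  | outLeft (a : A)
  /-- the corner where `a` enters through the right boundary and leaves at the bottom -/
  | inRight (a : A)
  /-- vertical identity cell on an object -/
  | vid (a : A)
  /-- horizontal identity cell on an exchange -/
  | hid (X : Exchange A)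
  | hcomp (x y : RawCell A)
  | vcomp (x y : RawCell A)

namespace RawCell

variable {A : Type u} [Category.{v} A] [MonoidalCategory A]

/-- top boundary -/
@[simp] def top : RawCell A → A
  | @vert _ _ a _ _ => a
  | outRight a => a
  | inLeft _ => 𝟙_ A
  | outLeft a => a
  | inRight _ => 𝟙_ A
  | vid a => a
  | hid _ => 𝟙_ A
  | hcomp x y => top x ⊗ top y
  | vcomp x _ => top x

/-- bottom boundary -/
@[simp] def bottom : RawCell A → A
  | @vert _ _ _ b _ => b
  | outRight _ => 𝟙_ A
  | inLeft a => a
  | outLeft _ => 𝟙_ A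
  | inRight a => a
  | vid a => a
  | hid _ => 𝟙_ A
  | hcomp x y => bottom x ⊗ bottom y
  | vcomp _ y => bottom y

/-- left boundary -/
@[simp] def left : RawCell A → Exchange A
  | vert _ => []
  | outRight _ => []
  | inLeft a => [(a, .ltr)]
  | outLeft a => [(a, .rtl)]
  | inRight _ => []
  | vid _ => []
  | hid X => X
  | hcomp x _ => left x
  | vcomp x y => left x ++ left y

/-- right boundary -/
@[simp] def right : RawCell A → Exchange A
  | vert _ => []
  | outRight a => [(a, .ltr)]
  | inLeft _ => []
  | outLeft _ => []
  | inRight a => [(a, .rtl)]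
  | vid _ => []
  | hid X => X
  | hcomp _ y => right y
  | vcomp x y => right x ++ right y

/-- A formal pasting is composable if the boundaries match in each of the compositions in it. -/
@[simp] def Composable : RawCell A → Prop
  | hcomp x y => Composable x ∧ Composable y ∧ right x = left y
  | vcomp x y => Composable x ∧ Composable y ∧ bottom x = top y
  | _ => True

/-- The congruence on composable pastings that is generated by the equations of a double category
and the equations of the free cornering. -/
inductive Rel : RawCell A → RawCell A → Prop
  -- equivalence relation and congruence
  | refl {x} : Composable x → Rel x x
  | symm {x y} : Rel x y → Rel y x
  | trans {x y z} : Rel x y → Rel y z → Rel x z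
  | hcomp_congr {x x' y y'} : Rel x x' → Rel y y' → right x = left y →
      Rel (hcomp x y) (hcomp x' y')
  | vcomp_congr {x x' y y'} : Rel x x' → Rel y y' → bottom x = top y →
      Rel (vcomp x y) (vcomp x' y')
  -- equations of a double category
  | hcomp_assoc {x y z} : Composable (hcomp (hcomp x y) z) →
      Rel (hcomp (hcomp x y) z) (hcomp x (hcomp y z))
  | hid_hcomp {x} : Composable x → Rel (hcomp (hid (left x)) x) x
  | hcomp_hid {x} : Composable x → Rel (hcomp x (hid (right x))) x
  | vcomp_assoc {x y z} : Composable (vcomp (vcomp x y) z) →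
      Rel (vcomp (vcomp x y) z) (vcomp x (vcomp y z))
  | vid_vcomp {x} : Composable x → Rel (vcomp (vid (top x)) x) x
  | vcomp_vid {x} : Composable x → Rel (vcomp x (vid (bottom x))) x
  | interchange {x y z w} : Composable (hcomp (vcomp x y) (vcomp z w)) →
      Composable (vcomp (hcomp x z) (hcomp y w)) →
      Rel (hcomp (vcomp x y) (vcomp z w)) (vcomp (hcomp x z) (hcomp y w))
  | vid_hcomp_vid (a b : A) : Rel (hcomp (vid a) (vid b)) (vid (a ⊗ b))
  | hid_vcomp_hid (X Y : Exchange A) : Rel (vcomp (hid X) (hid Y)) (hid (X ++ Y))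
  | hid_nil : Rel (hid []) (vid (𝟙_ A))
  -- the assignment of cells to arrows is functorial and monoidal
  | vert_id (a : A) : Rel (vert (𝟙 a)) (vid a)
  | vert_comp {a b c : A} (f : a ⟶ b) (g : b ⟶ c) : Rel (vert (f ≫ g)) (vcomp (vert f) (vert g))
  | vert_tensor {a b c d : A} (f : a ⟶ b) (g : c ⟶ d) :
      Rel (vert (f ⊗ₘ g)) (hcomp (vert f) (vert g))
  -- the yanking equations of the two pairs of corners
  | yank_ltr_h (a : A) : Rel (hcomp (outRight a) (inLeft a)) (vid a)
  | yank_ltr_v (a : A) : Rel (vcomp (inLeft a) (outRight a)) (hid [(a, .ltr)])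
  | yank_rtl_h (a : A) : Rel (hcomp (inRight a) (outLeft a)) (vid a)
  | yank_rtl_v (a : A) : Rel (vcomp (inRight a) (outLeft a)) (hid [(a, .rtl)])

theorem Rel.spec [StrictMonoidal A] {x y : RawCell A} (h : Rel x y) :
    (Composable x ∧ Composable y) ∧ top x = top y ∧ bottom x = bottom y ∧
      left x = left y ∧ right x = right y := by
  induction h <;>
    simp_all [StrictMonoidal.tensor_assoc, StrictMonoidal.unit_tensor, StrictMonoidal.tensor_unit]

end RawCell

section Cell

variable (A : Type u) [Category.{v} A] [MonoidalCategory A]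

/-- The relation `RawCell.Rel` on composable pastings. -/
def cellSetoid : Setoid {x : RawCell A // x.Composable} where
  r x y := RawCell.Rel x.1 y.1
  iseqv := ⟨fun x => .refl x.2, .symm, .trans⟩

/-- The cells of the free cornering of `A`. -/
def Cell : Type (max u v) := Quotient (cellSetoid A)

end Cell

namespace Cell

variable {A : Type u} [Category.{v} A] [MonoidalCategory A]

/-- The cell denoted by a composable pasting. -/
def mk (x : RawCell A) (h : x.Composable) : Cell A := Quotient.mk (cellSetoid A) ⟨x, h⟩

theorem ind {p : Cell A → Prop} (h : ∀ x hx, p (mk x hx)) (x : Cell A) : p x :=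
  Quotient.ind (fun y => h y.1 y.2) x

variable [StrictMonoidal A]

theorem mk_eq {x y : RawCell A} (h : RawCell.Rel x y) :
    mk x h.spec.1.1 = mk y h.spec.1.2 := Quotient.sound (s := cellSetoid A) h

def top : Cell A → A :=
  Quotient.lift (fun x => x.1.top) fun _ _ h => (RawCell.Rel.spec h).2.1
def bottom : Cell A → A :=
  Quotient.lift (fun x => x.1.bottom) fun _ _ h => (RawCell.Rel.spec h).2.2.1
def left : Cell A → Exchange A :=
  Quotient.lift (fun x => x.1.left) fun _ _ h => (RawCell.Rel.spec h).2.2.2.1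
def right : Cell A → Exchange A :=
  Quotient.lift (fun x => x.1.right) fun _ _ h => (RawCell.Rel.spec h).2.2.2.2

/-- Horizontal composition `x | y` of cells. -/
def hcomp (x y : Cell A) : x.right = y.left → Cell A :=
  Quotient.hrecOn₂ (φ := fun x y : Cell A => x.right = y.left → Cell A) x y
    (fun x y h => mk (.hcomp x.1 y.1) ⟨x.2, y.2, h⟩) (by
      intro x y x' y' hx hy
      refine Function.hfunext ?_ fun h h' _ => heq_of_eq (mk_eq (.hcomp_congr hx hy h))
      exact congrArg₂ (· = ·) (RawCell.Rel.spec hx).2.2.2.2 (RawCell.Rel.spec hy).2.2.2.1)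

/-- Vertical composition of cells, `x` above `y`. -/
def vcomp (x y : Cell A) : x.bottom = y.top → Cell A :=
  Quotient.hrecOn₂ (φ := fun x y : Cell A => x.bottom = y.top → Cell A) x y
    (fun x y h => mk (.vcomp x.1 y.1) ⟨x.2, y.2, h⟩) (by
      intro x y x' y' hx hy
      refine Function.hfunext ?_ fun h h' _ => heq_of_eq (mk_eq (.vcomp_congr hx hy h))
      exact congrArg₂ (· = ·) (RawCell.Rel.spec hx).2.2.1 (RawCell.Rel.spec hy).2.1)

def vert {a b : A} (f : a ⟶ b) : Cell A := mk (.vert f) trivial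
def outRight (a : A) : Cell A := mk (.outRight a) trivial
def inLeft (a : A) : Cell A := mk (.inLeft a) trivial
def outLeft (a : A) : Cell A := mk (.outLeft a) trivial
def inRight (a : A) : Cell A := mk (.inRight a) trivial
def vid (a : A) : Cell A := mk (.vid a) trivial
def hid (X : Exchange A) : Cell A := mk (.hid X) trivial

@[simp] theorem top_vert {a b : A} (f : a ⟶ b) : (vert f).top = a := (rfl)
@[simp] theorem bottom_vert {a b : A} (f : a ⟶ b) : (vert f).bottom = b := (rfl)
@[simp] theorem left_vert {a b : A} (f : a ⟶ b) : (vert f).left = [] := (rfl)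
@[simp] theorem right_vert {a b : A} (f : a ⟶ b) : (vert f).right = [] := (rfl)
@[simp] theorem top_outRight (a : A) : (outRight a).top = a := (rfl)
@[simp] theorem bottom_outRight (a : A) : (outRight a).bottom = 𝟙_ A := (rfl)
@[simp] theorem left_outRight (a : A) : (outRight a).left = [] := (rfl)
@[simp] theorem right_outRight (a : A) : (outRight a).right = [(a, .ltr)] := (rfl)
@[simp] theorem top_inLeft (a : A) : (inLeft a).top = 𝟙_ A := (rfl)
@[simp] theorem bottom_inLeft (a : A) : (inLeft a).bottom = a := (rfl)
@[simp] theorem left_inLeft (a : A) : (inLeft a).left = [(a, .ltr)] := (rfl)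
@[simp] theorem right_inLeft (a : A) : (inLeft a).right = [] := (rfl)
@[simp] theorem top_outLeft (a : A) : (outLeft a).top = a := (rfl)
@[simp] theorem bottom_outLeft (a : A) : (outLeft a).bottom = 𝟙_ A := (rfl)
@[simp] theorem left_outLeft (a : A) : (outLeft a).left = [(a, .rtl)] := (rfl)
@[simp] theorem right_outLeft (a : A) : (outLeft a).right = [] := (rfl)
@[simp] theorem top_inRight (a : A) : (inRight a).top = 𝟙_ A := (rfl)
@[simp] theorem bottom_inRight (a : A) : (inRight a).bottom = a := (rfl)
@[simp] theorem left_inRight (a : A) : (inRight a).left = [] := (rfl)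
@[simp] theorem right_inRight (a : A) : (inRight a).right = [(a, .rtl)] := (rfl)
@[simp] theorem top_vid (a : A) : (vid a).top = a := (rfl)
@[simp] theorem bottom_vid (a : A) : (vid a).bottom = a := (rfl)
@[simp] theorem left_vid (a : A) : (vid a).left = [] := (rfl)
@[simp] theorem right_vid (a : A) : (vid a).right = [] := (rfl)
@[simp] theorem top_hid (X : Exchange A) : (hid X).top = 𝟙_ A := (rfl)
@[simp] theorem bottom_hid (X : Exchange A) : (hid X).bottom = 𝟙_ A := (rfl)
@[simp] theorem left_hid (X : Exchange A) : (hid X).left = X := (rfl)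
@[simp] theorem right_hid (X : Exchange A) : (hid X).right = X := (rfl)

@[simp] theorem top_hcomp (x y : Cell A) (h) : (hcomp x y h).top = x.top ⊗ y.top := by
  induction x using ind; induction y using ind; rfl
@[simp] theorem bottom_hcomp (x y : Cell A) (h) : (hcomp x y h).bottom = x.bottom ⊗ y.bottom := by
  induction x using ind; induction y using ind; rfl
@[simp] theorem left_hcomp (x y : Cell A) (h) : (hcomp x y h).left = x.left := by
  induction x using ind; induction y using ind; rfl
@[simp] theorem right_hcomp (x y : Cell A) (h) : (hcomp x y h).right = y.right := by
  induction x using ind; induction y using ind; rfl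
@[simp] theorem top_vcomp (x y : Cell A) (h) : (vcomp x y h).top = x.top := by
  induction x using ind; induction y using ind; rfl
@[simp] theorem bottom_vcomp (x y : Cell A) (h) : (vcomp x y h).bottom = y.bottom := by
  induction x using ind; induction y using ind; rfl
@[simp] theorem left_vcomp (x y : Cell A) (h) : (vcomp x y h).left = x.left ++ y.left := by
  induction x using ind; induction y using ind; rfl
@[simp] theorem right_vcomp (x y : Cell A) (h) : (vcomp x y h).right = x.right ++ y.right := by
  induction x using ind; induction y using ind; rfl

theorem hcomp_congr {x x' y y' : Cell A} (hx : x = x') (hy : y = y') (h) :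
    hcomp x y h = hcomp x' y' (hx ▸ hy ▸ h) := by subst hx hy; rfl
theorem vcomp_congr {x x' y y' : Cell A} (hx : x = x') (hy : y = y') (h) :
    vcomp x y h = vcomp x' y' (hx ▸ hy ▸ h) := by subst hx hy; rfl

theorem hcomp_assoc (x y z : Cell A) (h : x.right = y.left) (h' : y.right = z.left) :
    hcomp (hcomp x y h) z (by simpa) = hcomp x (hcomp y z h') (by simpa) := by
  induction x using ind with | _ x hx
  induction y using ind with | _ y hy
  induction z using ind with | _ z hz
  exact mk_eq (.hcomp_assoc ⟨⟨hx, hy, h⟩, hz, h'⟩)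

theorem vcomp_assoc (x y z : Cell A) (h : x.bottom = y.top) (h' : y.bottom = z.top) :
    vcomp (vcomp x y h) z (by simpa) = vcomp x (vcomp y z h') (by simpa) := by
  induction x using ind with | _ x hx
  induction y using ind with | _ y hy
  induction z using ind with | _ z hz
  exact mk_eq (.vcomp_assoc ⟨⟨hx, hy, h⟩, hz, h'⟩)

theorem hid_hcomp (x : Cell A) {X : Exchange A} (h : (hid X).right = x.left) :
    hcomp (hid X) x h = x := by
  induction x using ind with | _ x hx
  obtain rfl : X = x.left := h
  exact mk_eq (.hid_hcomp hx)

theorem hcomp_hid (x : Cell A) {X : Exchange A} (h : x.right = (hid X).left) :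
    hcomp x (hid X) h = x := by
  induction x using ind with | _ x hx
  obtain rfl : x.right = X := h
  exact mk_eq (.hcomp_hid hx)

theorem vid_vcomp (x : Cell A) {a : A} (h : (vid a).bottom = x.top) :
    vcomp (vid a) x h = x := by
  induction x using ind with | _ x hx
  obtain rfl : a = x.top := h
  exact mk_eq (.vid_vcomp hx)

theorem vcomp_vid (x : Cell A) {a : A} (h : x.bottom = (vid a).top) :
    vcomp x (vid a) h = x := by
  induction x using ind with | _ x hx
  obtain rfl : x.bottom = a := h
  exact mk_eq (.vcomp_vid hx)

theorem interchange (x y z w : Cell A) (hxy : x.bottom = y.top) (hzw : z.bottom = w.top)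
    (hxz : x.right = z.left) (hyw : y.right = w.left) :
    hcomp (vcomp x y hxy) (vcomp z w hzw) (by simp [hxz, hyw]) =
      vcomp (hcomp x z hxz) (hcomp y w hyw) (by simp [hxy, hzw]) := by
  induction x using ind with | _ x hx
  induction y using ind with | _ y hy
  induction z using ind with | _ z hz
  induction w using ind with | _ w hw
  exact mk_eq (.interchange
    ⟨⟨hx, hy, hxy⟩, ⟨hz, hw, hzw⟩, congrArg₂ (· ++ ·) hxz hyw⟩
    ⟨⟨hx, hz, hxz⟩, ⟨hy, hw, hyw⟩, congrArg₂ (· ⊗ ·) hxy hzw⟩)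

theorem vid_hcomp_vid (a b : A) (h) : hcomp (vid a) (vid b) h = vid (a ⊗ b) :=
  mk_eq (.vid_hcomp_vid a b)
theorem hid_vcomp_hid (X Y : Exchange A) (h) : vcomp (hid X) (hid Y) h = hid (X ++ Y) :=
  mk_eq (.hid_vcomp_hid X Y)
theorem hid_nil : hid ([] : Exchange A) = vid (𝟙_ A) := mk_eq .hid_nil
theorem vert_id (a : A) : vert (𝟙 a) = vid a := mk_eq (.vert_id a)
theorem vert_comp {a b c : A} (f : a ⟶ b) (g : b ⟶ c) :
    vert (f ≫ g) = vcomp (vert f) (vert g) (by simp) := mk_eq (.vert_comp f g)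
theorem vert_tensor {a b c d : A} (f : a ⟶ b) (g : c ⟶ d) :
    vert (f ⊗ₘ g) = hcomp (vert f) (vert g) (by simp) := mk_eq (.vert_tensor f g)

theorem vert_eqToHom_comp {a b c : A} (h : a = b) (f : b ⟶ c) :
    vert (eqToHom h ≫ f) = vcomp (vid a) (vert f) (by simp [h]) := by
  subst h; simp [vid_vcomp]

theorem vert_eqToHom {a b : A} (h : a = b) : vert (eqToHom h) = vid a := by
  subst h; exact vert_id a

theorem vid_unit_hcomp (x : Cell A) (h : (vid (𝟙_ A)).right = x.left) :
    hcomp (vid (𝟙_ A)) x h = x :=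
  (hcomp_congr hid_nil.symm rfl h).trans (hid_hcomp x h)

theorem hcomp_vid_unit (x : Cell A) (h : x.right = (vid (𝟙_ A)).left) :
    hcomp x (vid (𝟙_ A)) h = x :=
  (hcomp_congr rfl hid_nil.symm h).trans (hcomp_hid x h)

/-- Auxiliary: a cell with prescribed boundaries `v`, `x`, `x'`, `v'` of a square of vertical
composites, `v` above `x` being equal to `x'` above `v'`. -/
def Slides (v x x' v' : Cell A) : Prop :=
  ∃ (h : v.bottom = x.top) (h' : x'.bottom = v'.top), vcomp v x h = vcomp x' v' h'

namespace Slides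

theorem vcomp {v x x' v' y y' v'' : Cell A} (h₁ : Slides v x x' v') (h₂ : Slides v' y y' v'')
    (h : x.bottom = y.top) (h' : x'.bottom = y'.top) :
    Slides v (Cell.vcomp x y h) (Cell.vcomp x' y' h') v'' := by
  obtain ⟨a, b, e⟩ := h₁
  obtain ⟨c, d, e'⟩ := h₂
  refine ⟨by simpa, by simpa, ?_⟩
  rw [← vcomp_assoc v x y a h, vcomp_congr e rfl, vcomp_assoc x' v' y b c, vcomp_congr rfl e',
    vcomp_assoc x' y' v'' h' d]

theorem hcomp {v x x' v' w y y' w' : Cell A} (h₁ : Slides v x x' v') (h₂ : Slides w y y' w')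
    (hv : v.right = w.left) (hx : x.right = y.left) (hx' : x'.right = y'.left)
    (hv' : v'.right = w'.left) :
    Slides (Cell.hcomp v w hv) (Cell.hcomp x y hx) (Cell.hcomp x' y' hx')
      (Cell.hcomp v' w' hv') := by
  obtain ⟨a, b, e⟩ := h₁
  obtain ⟨c, d, e'⟩ := h₂
  refine ⟨by simp [a, c], by simp [b, d], ?_⟩
  rw [← interchange v x w y a c hv hx, hcomp_congr e e', interchange]

theorem trans {v x y v' w z w' : Cell A} (h₁ : Slides v x y v') (h₂ : Slides w y z w')
    (h : w.bottom = v.top) (h' : w'.bottom = v'.top) :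
    Slides (Cell.vcomp w v h) x z (Cell.vcomp w' v' h') := by
  obtain ⟨a, b, e⟩ := h₁
  obtain ⟨c, d, e'⟩ := h₂
  refine ⟨by simpa, by simpa, ?_⟩
  rw [vcomp_assoc w v x h a, vcomp_congr rfl e, ← vcomp_assoc w y v' c b, vcomp_congr e' rfl,
    vcomp_assoc z w' v' d h']

theorem of_vid {a b : A} (x : Cell A) (h : x.top = a) (h' : x.bottom = b) :
    Slides (vid a) x x (vid b) :=
  ⟨by simp [h], by simp [h'], by rw [vid_vcomp, vcomp_vid]⟩

theorem vid_of {v : Cell A} {a b : A} (h : v.top = a) (h' : v.bottom = b) :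
    Slides v (vid b) (vid a) v :=
  ⟨by simp [h'], by simp [h], by rw [vid_vcomp, vcomp_vid]⟩

theorem vert {a b c d : A} {f : a ⟶ b} {g : b ⟶ d} {f' : a ⟶ c} {g' : c ⟶ d}
    (h : f ≫ g = f' ≫ g') : Slides (Cell.vert f) (Cell.vert g) (Cell.vert f') (Cell.vert g') :=
  ⟨by simp, by simp, by rw [← vert_comp, ← vert_comp, h]⟩

theorem inv {a b c d : A} {x y : Cell A} {f : a ≅ b} {g : c ≅ d}
    (h : Slides (Cell.vert f.hom) x y (Cell.vert g.hom)) (hy : y.top = a) (hx : x.bottom = d) :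
    Slides (Cell.vert f.inv) y x (Cell.vert g.inv) := by
  obtain ⟨p, q, e⟩ := h
  have e₁ : Cell.vcomp (Cell.vert g.hom) (Cell.vert g.inv) (by simp) = vid c := by
    rw [← vert_comp, g.hom_inv_id, vert_id]
  have e₂ : Cell.vcomp (Cell.vert f.inv) (Cell.vert f.hom) (by simp) = vid b := by
    rw [← vert_comp, f.inv_hom_id, vert_id]
  have q' : y.bottom = c := by simpa using q
  have p' : b = x.top := by simpa using p
  refine ⟨by simp [hy], by simp [hx], ?_⟩
  calc Cell.vcomp (Cell.vert f.inv) y (by simp [hy])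
      = Cell.vcomp (Cell.vert f.inv) (Cell.vcomp y (vid c) (by simp [q'])) (by simp [hy]) :=
        vcomp_congr rfl (vcomp_vid y (by simp [q'])).symm _
    _ = Cell.vcomp (Cell.vert f.inv) (Cell.vcomp (Cell.vcomp y (Cell.vert g.hom) q)
          (Cell.vert g.inv) (by simp)) (by simp [hy]) := by
        refine vcomp_congr rfl ?_ _
        rw [vcomp_assoc y _ _ q (by simp)]
        exact vcomp_congr rfl e₁.symm _
    _ = Cell.vcomp (Cell.vert f.inv) (Cell.vcomp (Cell.vcomp (Cell.vert f.hom) x p)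
          (Cell.vert g.inv) (by simp [hx])) (by simp) :=
        vcomp_congr rfl (vcomp_congr e.symm rfl _) _
    _ = Cell.vcomp (Cell.vert f.inv) (Cell.vcomp (Cell.vert f.hom) (Cell.vcomp x
          (Cell.vert g.inv) (by simp [hx])) (by simp [p'])) (by simp) :=
        vcomp_congr rfl (vcomp_assoc _ _ _ p (by simp [hx])) _
    _ = Cell.vcomp (Cell.vcomp (Cell.vert f.inv) (Cell.vert f.hom) (by simp)) (Cell.vcomp x
          (Cell.vert g.inv) (by simp [hx])) (by simp [p']) :=
        (vcomp_assoc _ _ _ (by simp) (by simp [p'])).symm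
    _ = Cell.vcomp (vid b) (Cell.vcomp x (Cell.vert g.inv) (by simp [hx])) (by simp [p']) :=
        vcomp_congr e₂ rfl _
    _ = Cell.vcomp x (Cell.vert g.inv) (by simp [hx]) := vid_vcomp _ _

end Slides

section Crossing

variable [SymmetricCategory A]

/-- The crossing of a wire `b`, from top to bottom, with a wire `a` from left to right: `a` enters
through the left boundary, is braided past `b`, and leaves through the right boundary. -/
def crossLtr (b a : A) : Cell A :=
  vcomp (vcomp (hcomp (inLeft a) (vid b) (by simp)) (vert (β_ a b).hom) (by simp))
    (hcomp (vid b) (outRight a) (by simp)) (by simp)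

/-- The crossing of a wire `b`, from top to bottom, with a wire `a` from right to left. -/
def crossRtl (b a : A) : Cell A :=
  vcomp (vcomp (hcomp (vid b) (inRight a) (by simp)) (vert (β_ b a).hom) (by simp))
    (hcomp (outLeft a) (vid b) (by simp)) (by simp)

def crossGen (b : A) : A × Polarity → Cell A
  | (a, .ltr) => crossLtr b a
  | (a, .rtl) => crossRtl b a

theorem crossGen_spec (b : A) (p : A × Polarity) :
    (crossGen b p).top = b ∧ (crossGen b p).bottom = b ∧
      (crossGen b p).left = [p] ∧ (crossGen b p).right = [p] := by
  obtain ⟨a, _ | _⟩ := p <;>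
    simp [crossGen, crossLtr, crossRtl, StrictMonoidal.unit_tensor, StrictMonoidal.tensor_unit]

def crossAux (b : A) : (X : Exchange A) →
    {x : Cell A // x.top = b ∧ x.bottom = b ∧ x.left = X ∧ x.right = X}
  | [] => ⟨vid b, by simp⟩
  | p :: X => ⟨vcomp (crossGen b p) (crossAux b X).1
      ((crossGen_spec b p).2.1.trans (crossAux b X).2.1.symm), by
        simp [crossGen_spec b p, (crossAux b X).2]⟩

/-- The crossing cell of a wire `b` with an exchange `X`: the crossings of `b` with the members
of `X`, from top to bottom. -/
def cross (b : A) (X : Exchange A) : Cell A := (crossAux b X).1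

@[simp] theorem top_cross (b : A) (X : Exchange A) : (cross b X).top = b := (crossAux b X).2.1
@[simp] theorem bottom_cross (b : A) (X : Exchange A) : (cross b X).bottom = b :=
  (crossAux b X).2.2.1
@[simp] theorem left_cross (b : A) (X : Exchange A) : (cross b X).left = X :=
  (crossAux b X).2.2.2.1
@[simp] theorem right_cross (b : A) (X : Exchange A) : (cross b X).right = X :=
  (crossAux b X).2.2.2.2

theorem cross_nil (b : A) : cross b [] = vid b := rfl

/-- The tensor product of cells: `x` passes through the left and `y` through the right, `x` being
above `y`; the wires of `y` cross the right boundary of `x`, and the wires of `x` cross the left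
boundary of `y`. -/
def tensor (x y : Cell A) : Cell A :=
  vcomp (hcomp x (cross y.top x.right) (by simp)) (hcomp (cross x.bottom y.left) y (by simp))
    (by simp)

@[simp] theorem top_tensor (x y : Cell A) : (tensor x y).top = x.top ⊗ y.top := by simp [tensor]
@[simp] theorem bottom_tensor (x y : Cell A) : (tensor x y).bottom = x.bottom ⊗ y.bottom := by
  simp [tensor]
@[simp] theorem left_tensor (x y : Cell A) : (tensor x y).left = x.left ++ y.left := by
  simp [tensor]
@[simp] theorem right_tensor (x y : Cell A) : (tensor x y).right = x.right ++ y.right := by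
  simp [tensor]

theorem tensor_vid (a b : A) : tensor (vid a) (vid b) = vid (a ⊗ b) := by
  simp [tensor, cross_nil, vid_hcomp_vid, vid_vcomp]

theorem slides_crossGen {a b : A} (f : a ⟶ b) (p : A × Polarity) :
    Slides (vert f) (crossGen b p) (crossGen a p) (vert f) := by
  have hl : vert f = hcomp (vid (𝟙_ A)) (vert f) (by simp) := (vid_unit_hcomp _ (by simp)).symm
  have hr : vert f = hcomp (vert f) (vid (𝟙_ A)) (by simp) := (hcomp_vid_unit _ (by simp)).symm
  have hL (p : A) : hcomp (vid p) (vert f) (by simp) = vert (𝟙 p ⊗ₘ f) := by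
    rw [vert_tensor]; exact hcomp_congr (vert_id p).symm rfl _
  have hR (p : A) : hcomp (vert f) (vid p) (by simp) = vert (f ⊗ₘ 𝟙 p) := by
    rw [vert_tensor]; exact hcomp_congr rfl (vert_id p).symm _
  obtain ⟨p, _ | _⟩ := p <;> simp only [crossGen, crossLtr, crossRtl]
  · refine .vcomp (v' := hcomp (vert f) (vid p) (by simp))
      (.vcomp (v' := hcomp (vid p) (vert f) (by simp)) ?_ ?_ _ _) ?_ _ _
    · have := Slides.hcomp (.of_vid (a := 𝟙_ A) (b := p) (inLeft p) rfl rfl)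
        (.vid_of (v := vert f) (a := a) (b := b) rfl rfl)
        (by simp) (by simp) (by simp) (by simp)
      rwa [← hl] at this
    · rw [hL, hR]
      exact .vert (BraidedCategory.braiding_naturality _ _)
    · have := Slides.hcomp (.vid_of (v := vert f) (a := a) (b := b) rfl rfl)
        (.of_vid (a := p) (b := 𝟙_ A) (outRight p) rfl rfl)
        (by simp) (by simp) (by simp) (by simp)
      rwa [← hr] at this
  · refine .vcomp (v' := hcomp (vid p) (vert f) (by simp))
      (.vcomp (v' := hcomp (vert f) (vid p) (by simp)) ?_ ?_ _ _) ?_ _ _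
    · have := Slides.hcomp (.vid_of (v := vert f) (a := a) (b := b) rfl rfl)
        (.of_vid (a := 𝟙_ A) (b := p) (inRight p) rfl rfl)
        (by simp) (by simp) (by simp) (by simp)
      rwa [← hr] at this
    · rw [hL, hR]
      exact .vert (BraidedCategory.braiding_naturality _ _)
    · have := Slides.hcomp (.of_vid (a := p) (b := 𝟙_ A) (outLeft p) rfl rfl)
        (.vid_of (v := vert f) (a := a) (b := b) rfl rfl)
        (by simp) (by simp) (by simp) (by simp)
      rwa [← hl] at this

theorem slides_cross {a b : A} (f : a ⟶ b) (X : Exchange A) :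
    Slides (vert f) (cross b X) (cross a X) (vert f) := by
  induction X with
  | nil => exact .vid_of rfl rfl
  | cons p X ih => exact (slides_crossGen f p).vcomp ih _ _

theorem Slides.tensor {a b c d a' b' c' d' : A} {f : a ⟶ b} {g : c ⟶ d} {f' : a' ⟶ b'}
    {g' : c' ⟶ d'} {x y x' y' : Cell A} (h : Slides (Cell.vert f) x y (Cell.vert g))
    (h' : Slides (Cell.vert f') x' y' (Cell.vert g')) (hy : y.top = a) (hx : x.bottom = d)
    (hy' : y'.top = a') (hx' : x'.bottom = d') (hr : x.right = y.right)
    (hl : x'.left = y'.left) :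
    Slides (Cell.vert (f ⊗ₘ f')) (Cell.tensor x x') (Cell.tensor y y')
      (Cell.vert (g ⊗ₘ g')) := by
  have e₁ : b' = x'.top := h'.1
  have e₂ : y.bottom = c := h.2.1
  subst hx hy hx' hy' e₁ e₂
  simp only [vert_tensor]
  refine Slides.vcomp (v' := Cell.hcomp (Cell.vert g) (Cell.vert f') (by simp)) ?_ ?_ _ _
  · refine h.hcomp ?_ _ _ _ _
    rw [hr]
    exact slides_cross f' _
  · refine Slides.hcomp ?_ h' _ _ _ _
    rw [hl]
    exact slides_cross g _

end Crossing

end Cell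

/-! ### Reflexive graphs and spans -/

/-- A reflexive graph: states `V`, transitions `E`, and a trivial transition at each state. -/
structure RGraph where
  V : Type s
  E : Type t
  src : E → V
  tgt : E → V
  triv : V → E
  src_triv : ∀ x, src (triv x) = x
  tgt_triv : ∀ x, tgt (triv x) = x

attribute [simp] RGraph.src_triv RGraph.tgt_triv

namespace RGraph

universe s₁ t₁ s₂ t₂ s₃ t₃ s₄ t₄

/-- Morphisms of reflexive graphs. -/
@[ext]
structure Hom (G : RGraph.{s₁, t₁}) (H : RGraph.{s₂, t₂}) where
  onV : G.V → H.V
  onE : G.E → H.E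
  src_onE : ∀ e, H.src (onE e) = onV (G.src e)
  tgt_onE : ∀ e, H.tgt (onE e) = onV (G.tgt e)
  onE_triv : ∀ x, onE (G.triv x) = H.triv (onV x)

attribute [simp] Hom.src_onE Hom.tgt_onE Hom.onE_triv

abbrev Hom.id (G : RGraph.{s₁, t₁}) : Hom G G :=
  ⟨fun x => x, fun e => e, fun _ => rfl, fun _ => rfl, fun _ => rfl⟩

/-- Composition of morphisms, in diagrammatic order. -/
abbrev Hom.comp {G : RGraph.{s₁, t₁}} {H : RGraph.{s₂, t₂}} {K : RGraph.{s₃, t₃}}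
    (f : Hom G H) (g : Hom H K) : Hom G K :=
  ⟨fun x => g.onV (f.onV x), fun e => g.onE (f.onE e), by simp, by simp, by simp⟩

/-- The graph with one vertex and only the trivial edge. -/
abbrev point : RGraph.{s, t} :=
  ⟨PUnit, PUnit, fun _ => ⟨⟩, fun _ => ⟨⟩, fun _ => ⟨⟩, fun _ => rfl, fun _ => rfl⟩

/-- Product of reflexive graphs. -/
abbrev prod (G : RGraph.{s, t}) (H : RGraph.{s, t}) : RGraph.{s, t} where
  V := G.V × H.V
  E := G.E × H.E
  src e := (G.src e.1, H.src e.2)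
  tgt e := (G.tgt e.1, H.tgt e.2)
  triv x := (G.triv x.1, H.triv x.2)
  src_triv := by simp
  tgt_triv := by simp

abbrev Hom.prodMap {G H G' H' : RGraph.{s, t}} (f : Hom G H) (f' : Hom G' H') :
    Hom (G.prod G') (H.prod H') :=
  ⟨fun x => (f.onV x.1, f'.onV x.2), fun e => (f.onE e.1, f'.onE e.2),
    by simp, by simp, by simp⟩

/-- Pullback of reflexive graphs. -/
abbrev pullback {G H K : RGraph.{s, t}} (f : Hom G K) (g : Hom H K) : RGraph.{s, t} where
  V := {x : G.V × H.V // f.onV x.1 = g.onV x.2}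
  E := {e : G.E × H.E // f.onE e.1 = g.onE e.2}
  src e := ⟨(G.src e.1.1, H.src e.1.2), by rw [← f.src_onE, e.2, g.src_onE]⟩
  tgt e := ⟨(G.tgt e.1.1, H.tgt e.1.2), by rw [← f.tgt_onE, e.2, g.tgt_onE]⟩
  triv x := ⟨(G.triv x.1.1, H.triv x.1.2), by simp [x.2]⟩
  src_triv := by simp
  tgt_triv := by simp

abbrev pullbackFst {G H K : RGraph.{s, t}} (f : Hom G K) (g : Hom H K) : Hom (pullback f g) G :=
  ⟨fun x => x.1.1, fun e => e.1.1, fun _ => rfl, fun _ => rfl, fun _ => rfl⟩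

abbrev pullbackSnd {G H K : RGraph.{s, t}} (f : Hom G K) (g : Hom H K) : Hom (pullback f g) H :=
  ⟨fun x => x.1.2, fun e => e.1.2, fun _ => rfl, fun _ => rfl, fun _ => rfl⟩

/-- Isomorphisms of reflexive graphs. -/
structure Iso (G H : RGraph.{s, t}) where
  hom : Hom G H
  inv : Hom H G
  hom_inv : hom.comp inv = Hom.id G
  inv_hom : inv.comp hom = Hom.id H

namespace Iso

variable {G H K : RGraph.{s, t}}

@[simp] theorem inv_hom_onV (e : Iso G H) (x : G.V) : e.inv.onV (e.hom.onV x) = x :=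
  congrFun (congrArg Hom.onV e.hom_inv) x
@[simp] theorem hom_inv_onV (e : Iso G H) (x : H.V) : e.hom.onV (e.inv.onV x) = x :=
  congrFun (congrArg Hom.onV e.inv_hom) x
@[simp] theorem inv_hom_onE (e : Iso G H) (x : G.E) : e.inv.onE (e.hom.onE x) = x :=
  congrFun (congrArg Hom.onE e.hom_inv) x
@[simp] theorem hom_inv_onE (e : Iso G H) (x : H.E) : e.hom.onE (e.inv.onE x) = x :=
  congrFun (congrArg Hom.onE e.inv_hom) x

abbrev refl (G : RGraph.{s, t}) : Iso G G := ⟨.id G, .id G, rfl, rfl⟩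

abbrev symm (e : Iso G H) : Iso H G := ⟨e.inv, e.hom, e.inv_hom, e.hom_inv⟩

abbrev trans (e : Iso G H) (f : Iso H K) : Iso G K :=
  ⟨e.hom.comp f.hom, f.inv.comp e.inv, by ext <;> simp, by ext <;> simp⟩

abbrev prodMap {G H G' H' : RGraph.{s, t}} (e : Iso G H) (e' : Iso G' H') :
    Iso (G.prod G') (H.prod H') :=
  ⟨e.hom.prodMap e'.hom, e.inv.prodMap e'.inv, by ext <;> simp, by ext <;> simp⟩

abbrev pullbackMap {G H K G' H' : RGraph.{s, t}} {f : Hom G K} {g : Hom H K} {f' : Hom G' K}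
    {g' : Hom H' K} (i : Iso G G') (j : Iso H H') (hi : i.hom.comp f' = f)
    (hj : j.hom.comp g' = g) : Iso (pullback f g) (pullback f' g') where
  hom :=
    { onV x := ⟨(i.hom.onV x.1.1, j.hom.onV x.1.2), by subst hi hj; exact x.2⟩
      onE e := ⟨(i.hom.onE e.1.1, j.hom.onE e.1.2), by subst hi hj; exact e.2⟩
      src_onE e := by simp
      tgt_onE e := by simp
      onE_triv x := by simp }
  inv :=
    { onV x := ⟨(i.inv.onV x.1.1, j.inv.onV x.1.2), by subst hi hj; simpa using x.2⟩
      onE e := ⟨(i.inv.onE e.1.1, j.inv.onE e.1.2), by subst hi hj; simpa using e.2⟩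
      src_onE e := by simp
      tgt_onE e := by simp
      onE_triv x := by simp }
  hom_inv := by ext <;> simp
  inv_hom := by ext <;> simp

/-- The pullback along an isomorphism. -/
abbrev pullbackFstIso {G H K : RGraph.{s, t}} (f : Hom G K) (g : Iso H K) :
    Iso (pullback f g.hom) G where
  hom := pullbackFst f g.hom
  inv :=
    { onV x := ⟨(x, g.inv.onV (f.onV x)), by simp⟩
      onE e := ⟨(e, g.inv.onE (f.onE e)), by simp⟩
      src_onE e := by simp
      tgt_onE e := by simp
      onE_triv x := by simp }
  hom_inv := by
    ext x
    · rfl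
    · simp [x.2]
    · rfl
    · simp [x.2]
  inv_hom := rfl

abbrev pullbackSndIso {G H K : RGraph.{s, t}} (f : Iso G K) (g : Hom H K) :
    Iso (pullback f.hom g) H where
  hom := pullbackSnd f.hom g
  inv :=
    { onV x := ⟨(f.inv.onV (g.onV x), x), by simp⟩
      onE e := ⟨(f.inv.onE (g.onE e), e), by simp⟩
      src_onE e := by simp
      tgt_onE e := by simp
      onE_triv x := by simp }
  hom_inv := by
    ext x
    · simp [← x.2]
    · rfl
    · simp [← x.2]
    · rfl
  inv_hom := rfl

abbrev prodAssoc (G H K : RGraph.{s, t}) : Iso ((G.prod H).prod K) (G.prod (H.prod K)) where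
  hom := ⟨fun x => (x.1.1, (x.1.2, x.2)), fun e => (e.1.1, (e.1.2, e.2)),
    fun _ => rfl, fun _ => rfl, fun _ => rfl⟩
  inv := ⟨fun x => ((x.1, x.2.1), x.2.2), fun e => ((e.1, e.2.1), e.2.2),
    fun _ => rfl, fun _ => rfl, fun _ => rfl⟩
  hom_inv := rfl
  inv_hom := rfl

abbrev pointProd (G : RGraph.{s, t}) : Iso (point.prod G) G where
  hom := ⟨fun x => x.2, fun e => e.2, fun _ => rfl, fun _ => rfl, fun _ => rfl⟩
  inv := ⟨fun x => (⟨⟩, x), fun e => (⟨⟩, e), fun _ => rfl, fun _ => rfl, fun _ => rfl⟩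
  hom_inv := rfl
  inv_hom := rfl

abbrev prodPoint (G : RGraph.{s, t}) : Iso (G.prod point) G where
  hom := ⟨fun x => x.1, fun e => e.1, fun _ => rfl, fun _ => rfl, fun _ => rfl⟩
  inv := ⟨fun x => (x, ⟨⟩), fun e => (e, ⟨⟩), fun _ => rfl, fun _ => rfl, fun _ => rfl⟩
  hom_inv := rfl
  inv_hom := rfl

end Iso

end RGraph

/-! ### Situated boundaries and situated transition systems -/

/-- The monoid of exchanges as a reflexive graph with a single vertex, the trivial edge being the
unit of the monoid. -/
abbrev exchangeGraph (A : Type u) : RGraph.{0, u} :=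
  ⟨Unit, Exchange A, fun _ => (), fun _ => (), fun _ => [], fun _ => rfl, fun _ => rfl⟩

theorem exchangeGraph_hom_ext {A : Type u} {G : RGraph.{s, t}} {f g : RGraph.Hom G (exchangeGraph A)}
    (h : ∀ e, f.onE e = g.onE e) : f = g := RGraph.Hom.ext (funext fun _ => rfl) (funext h)

section

variable (A : Type u) [Category.{v} A] [MonoidalCategory A] [StrictMonoidal A]

/-- The reflexive graph whose vertices are the objects of `A` and whose edges from `a` to `b` are
the cells with top boundary `a` and bottom boundary `b`; the trivial edges are the vertical
identity cells. -/
abbrev cellGraph : RGraph.{u, max u v} :=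
  ⟨A, Cell A, Cell.top, Cell.bottom, Cell.vid, by simp, by simp⟩

/-- The assignment to each cell of its left boundary. -/
abbrev leftBoundary : RGraph.Hom (cellGraph A) (exchangeGraph A) :=
  ⟨fun _ => (), Cell.left, fun _ => rfl, fun _ => rfl, fun _ => rfl⟩

/-- The assignment to each cell of its right boundary. -/
abbrev rightBoundary : RGraph.Hom (cellGraph A) (exchangeGraph A) :=
  ⟨fun _ => (), Cell.right, fun _ => rfl, fun _ => rfl, fun _ => rfl⟩

end

/-- An `A`-situated boundary. -/
structure SituatedBoundary (A : Type u) where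
  graph : RGraph.{s, t}
  /-- the situation -/
  sit : RGraph.Hom graph (exchangeGraph A)

/-- An `A`-situated transition system from `U` to `V`: a span of reflexive graphs, together with a
coherent situation of its apex. -/
structure SituatedSystem {A : Type u} [Category.{v} A] [MonoidalCategory A] [StrictMonoidal A]
    (U V : SituatedBoundary.{s, t} A) where
  apex : RGraph.{s, t}
  legL : RGraph.Hom apex U.graph
  legR : RGraph.Hom apex V.graph
  /-- the situation -/
  sit : RGraph.Hom apex (cellGraph A)
  coherentL : legL.comp U.sit = sit.comp (leftBoundary A)
  coherentR : legR.comp V.sit = sit.comp (rightBoundary A)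

namespace SituatedSystem

variable {A : Type u} [Category.{v} A] [MonoidalCategory A] [StrictMonoidal A]
  {U V W Z U' V' : SituatedBoundary.{s, t} A}

/-- The object of `A` that is assigned to a state. -/
def obj (R : SituatedSystem U V) (x : R.apex.V) : A := R.sit.onV x

/-- The cell that is assigned to a transition. -/
def cell (R : SituatedSystem U V) (e : R.apex.E) : Cell A := R.sit.onE e

@[simp] theorem top_cell (R : SituatedSystem U V) (e) : (R.cell e).top = R.obj (R.apex.src e) :=
  R.sit.src_onE e
@[simp] theorem bottom_cell (R : SituatedSystem U V) (e) :
    (R.cell e).bottom = R.obj (R.apex.tgt e) := R.sit.tgt_onE e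
@[simp] theorem left_cell (R : SituatedSystem U V) (e) :
    (R.cell e).left = U.sit.onE (R.legL.onE e) :=
  (congrFun (congrArg RGraph.Hom.onE R.coherentL) e).symm
@[simp] theorem right_cell (R : SituatedSystem U V) (e) :
    (R.cell e).right = V.sit.onE (R.legR.onE e) :=
  (congrFun (congrArg RGraph.Hom.onE R.coherentR) e).symm
@[simp] theorem cell_triv (R : SituatedSystem U V) (x) :
    R.cell (R.apex.triv x) = Cell.vid (R.obj x) := R.sit.onE_triv x

/-- Coherent isomorphism of situated transition systems: an isomorphism `i` of the underlying
spans, with a natural isomorphism from the situation of `R` to the situation of `S` restricted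
along `i`. -/
def Equivalent (R S : SituatedSystem U V) : Prop :=
  ∃ i : RGraph.Iso R.apex S.apex,
    i.hom.comp S.legL = R.legL ∧ i.hom.comp S.legR = R.legR ∧
    ∃ ι : ∀ x : R.apex.V, R.obj x ≅ S.obj (i.hom.onV x),
      ∀ e : R.apex.E,
        Cell.vcomp (R.cell e) (Cell.vert (ι (R.apex.tgt e)).hom) (by simp) =
          Cell.vcomp (Cell.vert (ι (R.apex.src e)).hom) (S.cell (i.hom.onE e)) (by simp)

theorem Equivalent.mk' {R S : SituatedSystem U V} (i : RGraph.Iso R.apex S.apex)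
    (hL : i.hom.comp S.legL = R.legL) (hR : i.hom.comp S.legR = R.legR)
    (ι : ∀ x : R.apex.V, R.obj x ≅ S.obj (i.hom.onV x))
    (h : ∀ e, Cell.Slides (Cell.vert (ι (R.apex.src e)).hom) (S.cell (i.hom.onE e)) (R.cell e)
      (Cell.vert (ι (R.apex.tgt e)).hom)) : Equivalent R S :=
  ⟨i, hL, hR, ι, fun e => (h e).2.2.symm⟩

theorem Equivalent.exists_slides {R S : SituatedSystem U V} (h : Equivalent R S) :
    ∃ i : RGraph.Iso R.apex S.apex,
      i.hom.comp S.legL = R.legL ∧ i.hom.comp S.legR = R.legR ∧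
      ∃ ι : ∀ x : R.apex.V, R.obj x ≅ S.obj (i.hom.onV x),
        ∀ e, Cell.Slides (Cell.vert (ι (R.apex.src e)).hom) (S.cell (i.hom.onE e)) (R.cell e)
          (Cell.vert (ι (R.apex.tgt e)).hom) := by
  obtain ⟨i, hL, hR, ι, h⟩ := h
  exact ⟨i, hL, hR, ι, fun e => ⟨_, _, (h e).symm⟩⟩

/-- Systems whose situations agree on the nose along an isomorphism of spans are equivalent. -/
theorem Equivalent.of_eq {R S : SituatedSystem U V} (i : RGraph.Iso R.apex S.apex)
    (hL : i.hom.comp S.legL = R.legL) (hR : i.hom.comp S.legR = R.legR)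
    (hV : ∀ x, R.obj x = S.obj (i.hom.onV x))
    (hE : ∀ e, R.cell e = S.cell (i.hom.onE e)) : Equivalent R S := by
  refine .mk' i hL hR (fun x => eqToIso (hV x)) fun e => ?_
  simp only [eqToIso.hom, Cell.vert_eqToHom, ← hE]
  exact .of_vid _ (by simp) (by simp)

theorem Equivalent.refl (R : SituatedSystem U V) : Equivalent R R :=
  .of_eq (.refl _) rfl rfl (fun _ => rfl) (fun _ => rfl)

theorem Equivalent.symm {R S : SituatedSystem U V} (h : Equivalent R S) : Equivalent S R := by
  obtain ⟨i, hL, hR, ι, h⟩ := h.exists_slides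
  have key (x : S.apex.V) : S.obj x = S.obj (i.hom.onV (i.inv.onV x)) := by simp
  refine .mk' i.symm ?_ ?_ (fun x => eqToIso (key x) ≪≫ (ι (i.inv.onV x)).symm) fun e => ?_
  · rw [← hL]; ext <;> simp
  · rw [← hR]; ext <;> simp
  · have := (h (i.inv.onE e)).inv (by simp) (by simp)
    rw [RGraph.Iso.hom_inv_onE, RGraph.Hom.src_onE, RGraph.Hom.tgt_onE] at this
    simpa only [Iso.trans_hom, eqToIso.hom, Iso.symm_hom, Cell.vert_eqToHom_comp, Cell.vid_vcomp] using this

theorem Equivalent.trans {R S T : SituatedSystem U V} (h : Equivalent R S)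
    (h' : Equivalent S T) : Equivalent R T := by
  obtain ⟨i, hL, hR, ι, h⟩ := h.exists_slides
  obtain ⟨j, kL, kR, κ, k⟩ := h'.exists_slides
  refine .mk' (i.trans j) ?_ ?_ (fun x => ι x ≪≫ κ (i.hom.onV x)) fun e => ?_
  · rw [← hL, ← kL]
  · rw [← hR, ← kR]
  · have := k (i.hom.onE e)
    rw [RGraph.Hom.src_onE, RGraph.Hom.tgt_onE] at this
    have := this.trans (h e) (by simp) (by simp)
    simp only [← Cell.vert_comp] at this
    exact this

def setoid (U V : SituatedBoundary.{s, t} A) : Setoid (SituatedSystem U V) :=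
  ⟨Equivalent, .refl, .symm, .trans⟩

/-- The identity system: the identity span, situated by horizontal identity cells. -/
abbrev id (U : SituatedBoundary.{s, t} A) : SituatedSystem U U where
  apex := U.graph
  legL := .id _
  legR := .id _
  sit :=
    { onV _ := 𝟙_ A
      onE e := Cell.hid (U.sit.onE e)
      src_onE _ := rfl
      tgt_onE _ := rfl
      onE_triv x := by rw [U.sit.onE_triv]; exact Cell.hid_nil }
  coherentL := rfl
  coherentR := rfl

/-- Composition of systems: the pullback of the spans, situated by horizontal composition. -/
abbrev comp (R : SituatedSystem U V) (S : SituatedSystem V W) : SituatedSystem U W where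
  apex := RGraph.pullback R.legR S.legL
  legL := (RGraph.pullbackFst _ _).comp R.legL
  legR := (RGraph.pullbackSnd _ _).comp S.legR
  sit :=
    { onV x := (R.obj x.1.1 ⊗ S.obj x.1.2 : A)
      onE e := Cell.hcomp (R.cell e.1.1) (S.cell e.1.2) (by
        rw [right_cell, left_cell, e.2])
      src_onE e := by simp
      tgt_onE e := by simp
      onE_triv x := by simp [Cell.vid_hcomp_vid] }
  coherentL := exchangeGraph_hom_ext fun e => by
    rw [RGraph.Hom.comp]; simp
  coherentR := exchangeGraph_hom_ext fun e => by
    rw [RGraph.Hom.comp]; simp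

theorem Equivalent.comp {R R' : SituatedSystem U V} {S S' : SituatedSystem V W}
    (h : Equivalent R R') (h' : Equivalent S S') : Equivalent (R.comp S) (R'.comp S') := by
  obtain ⟨i, hL, hR, ι, h⟩ := h.exists_slides
  obtain ⟨j, kL, kR, κ, k⟩ := h'.exists_slides
  refine .mk' (.pullbackMap i j hR kL) ?_ ?_ (fun x => ι x.1.1 ⊗ᵢ κ x.1.2) fun e => ?_
  · exact congrArg ((RGraph.pullbackFst R.legR S.legL).comp ·) hL
  · exact congrArg ((RGraph.pullbackSnd R.legR S.legL).comp ·) kR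
  · have := (h e.1.1).hcomp (k e.1.2) (by simp) (by
        rw [right_cell, left_cell]
        exact congrArg V.sit.onE ((RGraph.Iso.pullbackMap i j hR kL).hom.onE e).2)
      (by rw [right_cell, left_cell, e.2]) (by simp)
    simp only [← Cell.vert_tensor] at this
    exact this

theorem id_comp (R : SituatedSystem U V) : Equivalent ((id U).comp R) R := by
  refine .of_eq (.pullbackSndIso (.refl _) R.legL) ?_ rfl (fun x => ?_) fun e => ?_
  · ext x
    · exact x.2.symm
    · exact x.2.symm
  · exact StrictMonoidal.unit_tensor (R.obj x.1.2)
  · exact Cell.hid_hcomp (X := U.sit.onE e.1.1) (R.cell e.1.2)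
      (((left_cell R e.1.2).trans (congrArg U.sit.onE e.2.symm)).symm)

theorem comp_id (R : SituatedSystem U V) : Equivalent (R.comp (id V)) R := by
  refine .of_eq (.pullbackFstIso R.legR (.refl _)) rfl ?_ (fun x => ?_) fun e => ?_
  · ext x
    · exact x.2
    · exact x.2
  · exact StrictMonoidal.tensor_unit (R.obj x.1.1)
  · exact Cell.hcomp_hid (R.cell e.1.1) _

theorem comp_assoc (R : SituatedSystem U V) (S : SituatedSystem V W) (T : SituatedSystem W Z) :
    Equivalent ((R.comp S).comp T) (R.comp (S.comp T)) := by
  refine .of_eq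
    { hom := ⟨fun x => ⟨(x.1.1.1.1, ⟨(x.1.1.1.2, x.1.2), x.2⟩), x.1.1.2⟩,
        fun x => ⟨(x.1.1.1.1, ⟨(x.1.1.1.2, x.1.2), x.2⟩), x.1.1.2⟩,
        fun _ => rfl, fun _ => rfl, fun _ => rfl⟩
      inv := ⟨fun x => ⟨(⟨(x.1.1, x.1.2.1.1), x.2⟩, x.1.2.1.2), x.1.2.2⟩,
        fun x => ⟨(⟨(x.1.1, x.1.2.1.1), x.2⟩, x.1.2.1.2), x.1.2.2⟩,
        fun _ => rfl, fun _ => rfl, fun _ => rfl⟩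
      hom_inv := rfl
      inv_hom := rfl } rfl rfl (fun x => ?_) fun e => ?_
  · exact StrictMonoidal.tensor_assoc (R.obj x.1.1.1.1) (S.obj x.1.1.1.2) (T.obj x.1.2)
  · exact Cell.hcomp_assoc _ _ _ (by simp [e.1.1.2]) (by
      rw [right_cell, left_cell]
      exact congrArg W.sit.onE e.2)

/-- The system of an isomorphism of graphs that preserves the situations: the span whose legs are
the identity and the isomorphism, situated by horizontal identity cells. -/
abbrev ofGraphIso (i : RGraph.Iso U.graph V.graph) (h : i.hom.comp V.sit = U.sit) :
    SituatedSystem U V where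
  apex := U.graph
  legL := .id _
  legR := i.hom
  sit := (id U).sit
  coherentL := rfl
  coherentR := h

theorem ofGraphIso_comp_symm (i : RGraph.Iso U.graph V.graph) (h : i.hom.comp V.sit = U.sit)
    (h' : i.symm.hom.comp U.sit = V.sit) :
    Equivalent ((ofGraphIso i h).comp (ofGraphIso i.symm h')) (id U) := by
  refine .of_eq (.pullbackFstIso i.hom (.refl _)) rfl ?_ (fun x => ?_) fun e => ?_
  · ext x
    · have := x.2
      simp only at this
      simp [← this]
    · have := x.2
      simp only at this
      simp [← this]
  · exact StrictMonoidal.unit_tensor (𝟙_ A)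
  · have : V.sit.onE e.1.2 = U.sit.onE e.1.1 := by
      rw [← congrArg (fun f => f.onE e.1.1) h]
      exact congrArg V.sit.onE e.2.symm
    refine (Cell.hcomp_congr (x := Cell.hid (U.sit.onE e.1.1)) rfl (congrArg Cell.hid this) ?_).trans
      (Cell.hid_hcomp _ (by simp))
    simp [this]

end SituatedSystem

namespace SituatedBoundary

variable {A : Type u}

/-- The tensor product of situated boundaries. -/
abbrev tensor (U V : SituatedBoundary.{s, t} A) : SituatedBoundary.{s, t} A where
  graph := U.graph.prod V.graph
  sit :=
    { onV _ := ()
      onE e := (U.sit.onE e.1 ++ V.sit.onE e.2 : Exchange A)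
      src_onE _ := rfl
      tgt_onE _ := rfl
      onE_triv x := by simp }

/-- The unit of the tensor product: the graph with one vertex and only the trivial edge. -/
abbrev unit (A : Type u) : SituatedBoundary.{s, t} A :=
  ⟨RGraph.point, ⟨fun _ => (), fun _ => [], fun _ => rfl, fun _ => rfl, fun _ => rfl⟩⟩

variable [Category.{v} A] [MonoidalCategory A] [StrictMonoidal A]

/-- The category `S(A)` of situated transition systems: objects are situated boundaries, and
morphisms are situated transition systems modulo coherent isomorphism. -/
instance category : Category (SituatedBoundary.{s, t} A) where
  Hom U V := Quotient (SituatedSystem.setoid U V)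
  id U := Quotient.mk _ (SituatedSystem.id U)
  comp := Quotient.map₂ SituatedSystem.comp
    fun _ _ h _ _ h' => SituatedSystem.Equivalent.comp h h'
  id_comp f := Quotient.inductionOn f fun R => Quotient.sound (SituatedSystem.id_comp R)
  comp_id f := Quotient.inductionOn f fun R => Quotient.sound (SituatedSystem.comp_id R)
  assoc f g h := Quotient.inductionOn₃ f g h fun R S T =>
    Quotient.sound (SituatedSystem.comp_assoc R S T)

/-- The morphism of `S(A)` that is represented by a situated transition system. -/
def homMk {U V : SituatedBoundary.{s, t} A} (R : SituatedSystem U V) : U ⟶ V :=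
  Quotient.mk (SituatedSystem.setoid U V) R

theorem homMk_eq_iff {U V : SituatedBoundary.{s, t} A} (R S : SituatedSystem U V) :
    homMk R = homMk S ↔ R.Equivalent S :=
  ⟨fun h => Quotient.exact (s := SituatedSystem.setoid U V) h,
    fun h => Quotient.sound (s := SituatedSystem.setoid U V) h⟩

theorem homMk_id (U : SituatedBoundary.{s, t} A) : homMk (SituatedSystem.id U) = 𝟙 U := rfl

theorem homMk_comp {U V W : SituatedBoundary.{s, t} A} (R : SituatedSystem U V)
    (S : SituatedSystem V W) : homMk (R.comp S) = homMk R ≫ homMk S := rfl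

/-- The isomorphism in `S(A)` of an isomorphism of graphs that preserves the situations. -/
def isoOfGraphIso {U V : SituatedBoundary.{s, t} A} (i : RGraph.Iso U.graph V.graph)
    (h : i.hom.comp V.sit = U.sit) : U ≅ V :=
  have h' : i.symm.hom.comp U.sit = V.sit := by rw [← h]; ext; all_goals simp
  { hom := homMk (SituatedSystem.ofGraphIso i h)
    inv := homMk (SituatedSystem.ofGraphIso i.symm h')
    hom_inv_id := (homMk_eq_iff _ _).2 (SituatedSystem.ofGraphIso_comp_symm i h h')
    inv_hom_id := (homMk_eq_iff _ _).2 (SituatedSystem.ofGraphIso_comp_symm i.symm h' h) }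

end SituatedBoundary

namespace SituatedSystem

variable {A : Type u} [Category.{v} A] [MonoidalCategory A] [StrictMonoidal A]
  [SymmetricCategory A] {U V U' V' : SituatedBoundary.{s, t} A}

/-- The tensor product of systems: the product of the spans, situated by the tensor product of
cells. -/
abbrev tensor (R : SituatedSystem U V) (S : SituatedSystem U' V') :
    SituatedSystem (U.tensor U') (V.tensor V') where
  apex := R.apex.prod S.apex
  legL := R.legL.prodMap S.legL
  legR := R.legR.prodMap S.legR
  sit :=
    { onV x := (R.obj x.1 ⊗ S.obj x.2 : A)
      onE e := Cell.tensor (R.cell e.1) (S.cell e.2)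
      src_onE e := by simp
      tgt_onE e := by simp
      onE_triv x := by simp [Cell.tensor_vid] }
  coherentL := exchangeGraph_hom_ext (by simp)
  coherentR := exchangeGraph_hom_ext (by simp)

theorem Equivalent.tensor {R R' : SituatedSystem U V} {S S' : SituatedSystem U' V'}
    (h : Equivalent R R') (h' : Equivalent S S') : Equivalent (R.tensor S) (R'.tensor S') := by
  obtain ⟨i, hL, hR, ι, h⟩ := h.exists_slides
  obtain ⟨j, kL, kR, κ, k⟩ := h'.exists_slides
  refine .mk' (.prodMap i j) ?_ ?_ (fun x => ι x.1 ⊗ᵢ κ x.2) fun e => ?_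
  · exact congrArg₂ RGraph.Hom.prodMap hL kL
  · exact congrArg₂ RGraph.Hom.prodMap hR kR
  · refine (h e.1).tensor (k e.2) (by simp) (by simp) (by simp) (by simp) ?_ ?_
    · simp [← hR]
    · simp [← kL]

end SituatedSystem

namespace SituatedBoundary

variable {A : Type u} [Category.{v} A] [MonoidalCategory A] [StrictMonoidal A]
  [SymmetricCategory A]

/-- The tensor product of morphisms of `S(A)`. -/
def tensorHom {U V U' V' : SituatedBoundary.{s, t} A} (f : U ⟶ V) (g : U' ⟶ V') :
    U.tensor U' ⟶ V.tensor V' :=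
  Quotient.map₂ (sa := SituatedSystem.setoid U V) (sb := SituatedSystem.setoid U' V')
    (sc := SituatedSystem.setoid (U.tensor U') (V.tensor V'))
    SituatedSystem.tensor (fun _ _ h _ _ h' => SituatedSystem.Equivalent.tensor h h') f g

theorem homMk_tensor {U V U' V' : SituatedBoundary.{s, t} A} (R : SituatedSystem U V)
    (S : SituatedSystem U' V') : homMk (R.tensor S) = tensorHom (homMk R) (homMk S) := rfl

/-- The data of the monoidal structure on `S(A)`: the tensor product of situated boundaries and of
situated transition systems, the unit boundary, and the associators and unitors that come from the
associativity and unitality of the product of reflexive graphs. -/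
abbrev monoidalStruct (A : Type u) [Category.{v} A] [MonoidalCategory A] [StrictMonoidal A]
    [SymmetricCategory A] : MonoidalCategoryStruct (SituatedBoundary.{s, t} A) where
  tensorObj U V := U.tensor V
  tensorHom f g := tensorHom f g
  whiskerLeft U _ _ f := tensorHom (𝟙 U) f
  whiskerRight f V := tensorHom f (𝟙 V)
  tensorUnit := unit A
  associator U V W := isoOfGraphIso (.prodAssoc U.graph V.graph W.graph)
    (exchangeGraph_hom_ext fun _ => (List.append_assoc _ _ _).symm)
  leftUnitor U := isoOfGraphIso (.pointProd U.graph) (exchangeGraph_hom_ext fun _ => rfl)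
  rightUnitor U := isoOfGraphIso (.prodPoint U.graph)
    (exchangeGraph_hom_ext fun _ => (List.append_nil _).symm)

end SituatedBoundary

/-!
The heart of the matter is the calculus of crossings in the free cornering, proved at the level of
cells. The crossing of a wire `c` with an exchange is natural in *every* cell `x`: a cell can be
pulled through a wire that passes from its left to its right, the crossing of the wire with the
left boundary of `x` turning into the crossing with its right boundary (`Cell.slides_swap`). This
is proved by induction on the pasting. For the corners it is a yanking equation, for horizontal
composites the hexagon identity, and the vertical composites use that crossings with concatenated
exchanges are vertical composites (`Cell.cross_append`). Moreover, crossings are monoidal in the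
wire: crossing `b ⊗ c` means crossing `b` and then `c` (`Cell.cross_tensor`), and crossing the unit
is doing nothing (`Cell.cross_tensorUnit`).

These facts make the tensor product of cells strictly associative and unital, and make it preserve
horizontal identities. It preserves horizontal composition only up to the symmetry of the two inner
wires (`Cell.slides_tensor_hcomp`). That symmetry is an isomorphism of `A`, so it disappears when
situated systems are taken up to coherent isomorphism, and the tensor product becomes a functor on
`S(A)` (`SituatedBoundary.tensorHom_comp`).

The structural morphisms come from isomorphisms of graphs that preserve the situations. Sending such
an isomorphism to its system respects composition and tensor products, so the pentagon and triangle
identities reduce to identities between isomorphisms of graphs, which hold by definition. Naturality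
of the associators and unitors reduces to the strict associativity and unitality of the tensor
product of cells (`SituatedSystem.comp_ofGraphIso_equivalent`).
-/

namespace Cell

variable {A : Type u} [Category.{v} A] [MonoidalCategory A]

/-! ### Pastings of cells -/

theorem vert_comp_eqToHom {a b c : A} (f : a ⟶ b) (h : b = c) :
    vert (f ≫ eqToHom h) = vert f := by
  subst h; simp

theorem vert_eqToHom_comp_eq {a b c : A} (h : a = b) (f : b ⟶ c) :
    vert (eqToHom h ≫ f) = vert f := by
  subst h; simp

variable [StrictMonoidal A]

theorem associator_inv (a b c : A) :
    (α_ a b c).inv = eqToHom (StrictMonoidal.tensor_assoc a b c).symm := by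
  rw [Iso.inv_eq_inv (α_ a b c) (eqToIso (StrictMonoidal.tensor_assoc a b c)) |>.2]
  · rfl
  · simp [StrictMonoidal.associator_hom]

/-- `Cell.vcomp_assoc`, with the composability proofs of the left-hand side as variables, so that
it can be used for rewriting. -/
theorem vcomp_assoc' (x y z : Cell A) (h : x.bottom = y.top) (h' : (vcomp x y h).bottom = z.top) :
    vcomp (vcomp x y h) z h' = vcomp x (vcomp y z (by simpa using h')) (by simpa) :=
  vcomp_assoc x y z h (by simpa using h')

/-- `Cell.hcomp_assoc`, with the composability proofs of the left-hand side as variables, so that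
it can be used for rewriting. -/
theorem hcomp_assoc' (x y z : Cell A) (h : x.right = y.left) (h' : (hcomp x y h).right = z.left) :
    hcomp (hcomp x y h) z h' = hcomp x (hcomp y z (by simpa using h')) (by simpa) :=
  hcomp_assoc x y z h (by simpa using h')

theorem yank_ltr_h (a : A) : hcomp (outRight a) (inLeft a) (by simp) = vid a :=
  mk_eq (.yank_ltr_h a)

theorem yank_ltr_v (a : A) : vcomp (inLeft a) (outRight a) (by simp) = hid [(a, .ltr)] :=
  mk_eq (.yank_ltr_v a)

theorem yank_rtl_h (a : A) : hcomp (inRight a) (outLeft a) (by simp) = vid a :=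
  mk_eq (.yank_rtl_h a)

theorem yank_rtl_v (a : A) : vcomp (inRight a) (outLeft a) (by simp) = hid [(a, .rtl)] :=
  mk_eq (.yank_rtl_v a)

theorem vert_whiskerRight {a b : A} (f : a ⟶ b) (c : A) :
    vert (f ▷ c) = hcomp (vert f) (vid c) (by simp) := by
  rw [← tensorHom_id, vert_tensor]
  exact hcomp_congr rfl (vert_id c) _

theorem vert_whiskerLeft (c : A) {a b : A} (f : a ⟶ b) :
    vert (c ◁ f) = hcomp (vid c) (vert f) (by simp) := by
  rw [← id_tensorHom, vert_tensor]
  exact hcomp_congr (vert_id c) rfl _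

/-- If `z` has trivial left boundary, a cell `x` to the left of `y` above `z` can be moved up next to
`y`. The three lemmas that follow are its mirror images. -/
theorem hcomp_vcomp_of_left_nil (x y z : Cell A) (h : y.bottom = z.top)
    (h' : x.right = (vcomp y z h).left) (hz : z.left = []) :
    hcomp x (vcomp y z h) h' =
      vcomp (hcomp x y (by simpa [hz] using h')) (hcomp (vid x.bottom) z (by simp [hz]))
        (by simp [h]) := by
  rw [← interchange x (vid x.bottom) y z (by simp) h]
  exact hcomp_congr (vcomp_vid x (by simp)).symm rfl _

theorem hcomp_vcomp_of_left_nil' (x y z : Cell A) (h : y.bottom = z.top)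
    (h' : x.right = (vcomp y z h).left) (hy : y.left = []) :
    hcomp x (vcomp y z h) h' =
      vcomp (hcomp (vid x.top) y (by simp [hy])) (hcomp x z (by simpa [hy] using h'))
        (by simp [h]) := by
  rw [← interchange (vid x.top) x y z (by simp) h]
  exact hcomp_congr (vid_vcomp x (by simp)).symm rfl _

theorem vcomp_hcomp_of_right_nil (x y z : Cell A) (h : x.bottom = y.top)
    (h' : (vcomp x y h).right = z.left) (hy : y.right = []) :
    hcomp (vcomp x y h) z h' =
      vcomp (hcomp x z (by simpa [hy] using h')) (hcomp y (vid z.bottom) (by simp [hy]))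
        (by simp [h]) := by
  rw [← interchange x y z (vid z.bottom) h (by simp)]
  exact hcomp_congr rfl (vcomp_vid z (by simp)).symm _

theorem vcomp_hcomp_of_right_nil' (x y z : Cell A) (h : x.bottom = y.top)
    (h' : (vcomp x y h).right = z.left) (hx : x.right = []) :
    hcomp (vcomp x y h) z h' =
      vcomp (hcomp x (vid z.top) (by simp [hx])) (hcomp y z (by simpa [hx] using h'))
        (by simp [h]) := by
  rw [← interchange x y (vid z.top) z h (by simp)]
  exact hcomp_congr rfl (vid_vcomp z (by simp)).symm _

theorem vid_hcomp_vid_hcomp (a b : A) (x : Cell A) (h : (vid b).right = x.left)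
    (h' : (vid a).right = (hcomp (vid b) x h).left) :
    hcomp (vid a) (hcomp (vid b) x h) h' = hcomp (vid (a ⊗ b)) x (by simpa using h) := by
  rw [← hcomp_assoc _ _ _ (by simp)]
  exact hcomp_congr (vid_hcomp_vid a b _) rfl _

theorem hcomp_vid_hcomp_vid (x : Cell A) (a b : A) (h : x.right = (vid a).left)
    (h' : (hcomp x (vid a) h).right = (vid b).left) :
    hcomp (hcomp x (vid a) h) (vid b) h' = hcomp x (vid (a ⊗ b)) (by simpa using h) := by
  rw [hcomp_assoc']
  exact hcomp_congr rfl (vid_hcomp_vid a b _) _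

/-- To prove a property of all cells, it suffices to check it on the generating cells and to check
that it is stable under the two compositions. -/
theorem induction {p : Cell A → Prop} (vert : ∀ {a b : A} (f : a ⟶ b), p (vert f))
    (outRight : ∀ a, p (outRight a)) (inLeft : ∀ a, p (inLeft a)) (outLeft : ∀ a, p (outLeft a))
    (inRight : ∀ a, p (inRight a)) (vid : ∀ a, p (vid a)) (hid : ∀ X, p (hid X))
    (hcomp : ∀ x y h, p x → p y → p (hcomp x y h))
    (vcomp : ∀ x y h, p x → p y → p (vcomp x y h)) (x : Cell A) : p x := by
  induction x using ind with | _ x hx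
  induction x with
  | vert f => exact vert f
  | outRight a => exact outRight a
  | inLeft a => exact inLeft a
  | outLeft a => exact outLeft a
  | inRight a => exact inRight a
  | vid a => exact vid a
  | hid X => exact hid X
  | hcomp x y ihx ihy => exact hcomp (mk x hx.1) (mk y hx.2.1) hx.2.2 (ihx _) (ihy _)
  | vcomp x y ihx ihy => exact vcomp (mk x hx.1) (mk y hx.2.1) hx.2.2 (ihx _) (ihy _)

variable [SymmetricCategory A]

/-! ### The symmetry as a cell -/

/-- The cell of the symmetry of `A`. As an element of `Cell A`, a type that does not depend on the
objects involved, it can be rewritten along equations between these. -/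
def swap (a b : A) : Cell A := vert (β_ a b).hom

@[simp] theorem top_swap (a b : A) : (swap a b).top = a ⊗ b := (rfl)
@[simp] theorem bottom_swap (a b : A) : (swap a b).bottom = b ⊗ a := (rfl)
@[simp] theorem left_swap (a b : A) : (swap a b).left = [] := (rfl)
@[simp] theorem right_swap (a b : A) : (swap a b).right = [] := (rfl)

/-- The hexagon identity; in a strict category, the associators disappear at the level of cells. -/
theorem swap_tensor_right (a b c : A) :
    swap a (b ⊗ c) =
      vcomp (hcomp (swap a b) (vid c) (by simp))
        (hcomp (vid b) (swap a c) (by simp))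
        (by simp [StrictMonoidal.tensor_assoc]) := by
  have e : (β_ a (b ⊗ c)).hom = eqToHom (StrictMonoidal.tensor_assoc a b c).symm ≫
      (((β_ a b).hom ▷ c ≫ eqToHom (StrictMonoidal.tensor_assoc b a c)) ≫ b ◁ (β_ a c).hom) ≫
        eqToHom (StrictMonoidal.tensor_assoc b c a).symm := by
    simp [BraidedCategory.braiding_tensor_right_hom, associator_inv,
      StrictMonoidal.associator_hom]
  rw [swap, e, vert_eqToHom_comp_eq, vert_comp_eqToHom, vert_comp]
  simp only [vert_comp_eqToHom, vert_whiskerLeft, vert_whiskerRight]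
  rfl

theorem swap_tensorUnit_right (a : A) : swap a (𝟙_ A) = vid a := by
  have h : (λ_ a).inv = eqToHom (StrictMonoidal.unit_tensor a).symm := by
    rw [Iso.inv_eq_inv (λ_ a) (eqToIso (StrictMonoidal.unit_tensor a)) |>.2]
    · rfl
    · simp [StrictMonoidal.leftUnitor_hom]
  rw [swap, braiding_tensorUnit_right, h, StrictMonoidal.rightUnitor_hom, vert_comp_eqToHom,
    vert_eqToHom, StrictMonoidal.tensor_unit]

theorem swap_symm (a b : A) :
    vcomp (swap a b) (swap b a) (by simp) = vid (a ⊗ b) := by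
  unfold swap
  rw [← vert_comp, SymmetricCategory.symmetry, vert_id]

theorem swap_tensorUnit_left (a : A) : swap (𝟙_ A) a = vid a := by
  have h := swap_symm (𝟙_ A) a
  simpa only [swap_tensorUnit_right, StrictMonoidal.unit_tensor,
    vcomp_vid] using h

/-- The other hexagon identity. -/
theorem swap_tensor_left (a b c : A) :
    swap (a ⊗ b) c =
      vcomp (hcomp (vid a) (swap b c) (by simp))
        (hcomp (swap a c) (vid b) (by simp))
        (by simp [StrictMonoidal.tensor_assoc]) := by
  have e : (β_ (a ⊗ b) c).hom = eqToHom (StrictMonoidal.tensor_assoc a b c) ≫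
      ((a ◁ (β_ b c).hom ≫ eqToHom (StrictMonoidal.tensor_assoc a c b).symm) ≫
        (β_ a c).hom ▷ b) ≫ eqToHom (StrictMonoidal.tensor_assoc c a b) := by
    simp [BraidedCategory.braiding_tensor_left_hom, associator_inv,
      StrictMonoidal.associator_hom]
  rw [swap, e, vert_eqToHom_comp_eq, vert_comp_eqToHom, vert_comp]
  simp only [vert_comp_eqToHom, vert_whiskerLeft, vert_whiskerRight]
  rfl

/-! ### Crossings of a wire with a single exchange -/

theorem crossLtr_eq (b a : A) : crossLtr b a =
    vcomp (vcomp (hcomp (inLeft a) (vid b) (by simp)) (swap a b) (by simp))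
      (hcomp (vid b) (outRight a) (by simp)) (by simp) := (rfl)

theorem crossRtl_eq (b a : A) : crossRtl b a =
    vcomp (vcomp (hcomp (vid b) (inRight a) (by simp)) (swap b a) (by simp))
      (hcomp (outLeft a) (vid b) (by simp)) (by simp) := (rfl)

@[simp] theorem top_crossLtr (b a : A) : (crossLtr b a).top = b := (crossGen_spec b (a, .ltr)).1
@[simp] theorem bottom_crossLtr (b a : A) : (crossLtr b a).bottom = b :=
  (crossGen_spec b (a, .ltr)).2.1
@[simp] theorem left_crossLtr (b a : A) : (crossLtr b a).left = [(a, .ltr)] :=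
  (crossGen_spec b (a, .ltr)).2.2.1
@[simp] theorem right_crossLtr (b a : A) : (crossLtr b a).right = [(a, .ltr)] :=
  (crossGen_spec b (a, .ltr)).2.2.2
@[simp] theorem top_crossRtl (b a : A) : (crossRtl b a).top = b := (crossGen_spec b (a, .rtl)).1
@[simp] theorem bottom_crossRtl (b a : A) : (crossRtl b a).bottom = b :=
  (crossGen_spec b (a, .rtl)).2.1
@[simp] theorem left_crossRtl (b a : A) : (crossRtl b a).left = [(a, .rtl)] :=
  (crossGen_spec b (a, .rtl)).2.2.1
@[simp] theorem right_crossRtl (b a : A) : (crossRtl b a).right = [(a, .rtl)] :=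
  (crossGen_spec b (a, .rtl)).2.2.2

theorem outRight_hcomp_crossLtr (c a : A) :
    hcomp (outRight a) (crossLtr c a) (by simp) =
      vcomp (swap a c) (hcomp (vid c) (outRight a) (by simp)) (by simp) := by
  have h : hcomp (outRight a) (hcomp (inLeft a) (vid c) (by simp)) (by simp) = vid (a ⊗ c) := by
    rw [← hcomp_assoc _ _ _ (by simp) (by simp), hcomp_congr (yank_ltr_h a) rfl, vid_hcomp_vid]
  rw [hcomp_congr rfl (crossLtr_eq c a), hcomp_vcomp_of_left_nil _ _ _ _ _ (by simp)]
  simp only [hcomp_vcomp_of_left_nil _ _ _ _ _ (left_swap _ _), bottom_outRight, vid_unit_hcomp, h,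
    vid_vcomp]

theorem crossLtr_hcomp_inLeft (c a : A) :
    hcomp (crossLtr c a) (inLeft a) (by simp) =
      vcomp (hcomp (inLeft a) (vid c) (by simp)) (swap a c) (by simp) := by
  have h : hcomp (hcomp (vid c) (outRight a) (by simp)) (inLeft a) (by simp) = vid (c ⊗ a) := by
    rw [hcomp_assoc _ _ _ (by simp) (by simp), hcomp_congr rfl (yank_ltr_h a), vid_hcomp_vid]
  rw [hcomp_congr (crossLtr_eq c a) rfl, vcomp_hcomp_of_right_nil' _ _ _ _ _ (by simp)]
  simp only [top_inLeft, hcomp_vid_unit, h, vcomp_vid]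

theorem crossRtl_hcomp_outLeft (c a : A) :
    hcomp (crossRtl c a) (outLeft a) (by simp) =
      vcomp (swap c a) (hcomp (outLeft a) (vid c) (by simp)) (by simp) := by
  have h : hcomp (hcomp (vid c) (inRight a) (by simp)) (outLeft a) (by simp) = vid (c ⊗ a) := by
    rw [hcomp_assoc _ _ _ (by simp) (by simp), hcomp_congr rfl (yank_rtl_h a), vid_hcomp_vid]
  rw [hcomp_congr (crossRtl_eq c a) rfl, vcomp_hcomp_of_right_nil _ _ _ _ _ (by simp)]
  simp only [vcomp_hcomp_of_right_nil _ _ _ _ _ (right_swap _ _), bottom_outLeft, hcomp_vid_unit, h,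
    vid_vcomp]

theorem inRight_hcomp_crossRtl (c a : A) :
    hcomp (inRight a) (crossRtl c a) (by simp) =
      vcomp (hcomp (vid c) (inRight a) (by simp)) (swap c a) (by simp) := by
  have h : hcomp (inRight a) (hcomp (outLeft a) (vid c) (by simp)) (by simp) = vid (a ⊗ c) := by
    rw [← hcomp_assoc _ _ _ (by simp) (by simp), hcomp_congr (yank_rtl_h a) rfl, vid_hcomp_vid]
  rw [hcomp_congr rfl (crossRtl_eq c a), hcomp_vcomp_of_left_nil' _ _ _ _ _ (by simp)]
  simp only [top_inRight, vid_unit_hcomp, h, vcomp_vid]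

theorem crossLtr_tensor (b c a : A) :
    crossLtr (b ⊗ c) a = hcomp (crossLtr b a) (crossLtr c a) (by simp) := by
  -- The lowest row of the left crossing ends in a corner, which is moved down next to the right
  -- crossing and absorbed by `outRight_hcomp_crossLtr`. What remains is the hexagon identity.
  rw [hcomp_congr (crossLtr_eq b a) rfl, vcomp_hcomp_of_right_nil' _ _ _ _ _ (by simp)]
  have e (h h') := hcomp_vcomp_of_left_nil (vid b) (swap a c)
    (hcomp (vid c) (outRight a) (by simp)) h h' (by simp)
  simp only [hcomp_assoc', outRight_hcomp_crossLtr, top_crossLtr, e,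
    vcomp_hcomp_of_right_nil _ (swap a b) _ _ _ (right_swap _ _), bottom_vid,
    vid_hcomp_vid, vid_hcomp_vid_hcomp]
  simp only [crossLtr_eq, swap_tensor_right, vcomp_assoc']

theorem crossRtl_tensor (b c a : A) :
    crossRtl (b ⊗ c) a = hcomp (crossRtl b a) (crossRtl c a) (by simp) := by
  have e₁ : hcomp (crossRtl b a) (hcomp (outLeft a) (vid c) (by simp)) (by simp) =
      hcomp (vcomp (swap b a) (hcomp (outLeft a) (vid b) (by simp)) (by simp)) (vid c)
        (by simp) := by
    rw [← hcomp_assoc _ _ _ (by simp) (by simp), hcomp_congr (crossRtl_hcomp_outLeft b a) rfl]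
  have e₂ (h h') := vcomp_hcomp_of_right_nil' (swap b a)
    (hcomp (outLeft a) (vid b) (by simp)) (vid c) h h' (by simp)
  have e₃ (h h') := hcomp_vcomp_of_left_nil (vid b) (hcomp (vid c) (inRight a) (by simp))
    (swap c a) h h' (by simp)
  rw [hcomp_congr rfl (crossRtl_eq c a), hcomp_vcomp_of_left_nil' _ _ _ _ _ (by simp)]
  simp only [e₁, e₂, e₃, top_crossRtl, top_vid, bottom_vid, hcomp_vid_hcomp_vid,
    vid_hcomp_vid_hcomp]
  simp only [crossRtl_eq, swap_tensor_left, vcomp_assoc']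

/-! ### Crossings of a wire with a sequence of exchanges -/

theorem cross_cons (b : A) (p : A × Polarity) (X : Exchange A) :
    cross b (p :: X) = vcomp (crossGen b p) (cross b X)
      ((crossGen_spec b p).2.1.trans (top_cross b X).symm) := (rfl)

theorem cross_tensorUnit (X : Exchange A) : cross (𝟙_ A) X = hid X := by
  induction X with
  | nil => exact hid_nil.symm
  | cons p X ih =>
    have h : crossGen (𝟙_ A) p = hid [p] := by
      obtain ⟨a, _ | _⟩ := p
      · simp only [crossGen, crossLtr_eq, hcomp_vid_unit, vid_unit_hcomp,
          swap_tensorUnit_right, vcomp_vid, yank_ltr_v]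
      · simp only [crossGen, crossRtl_eq, hcomp_vid_unit, vid_unit_hcomp,
          swap_tensorUnit_left, vcomp_vid, yank_rtl_v]
    simp only [cross_cons, h, ih]
    exact hid_vcomp_hid [p] X _

theorem cross_append (b : A) (X Y : Exchange A) :
    cross b (X ++ Y) = vcomp (cross b X) (cross b Y) (by simp) := by
  induction X with
  | nil => simp only [List.nil_append, cross_nil, vid_vcomp]
  | cons p X ih => simp only [List.cons_append, cross_cons, ih, vcomp_assoc']

theorem cross_tensor (b c : A) (X : Exchange A) :
    cross (b ⊗ c) X = hcomp (cross b X) (cross c X) (by simp) := by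
  induction X with
  | nil => simp only [cross_nil, vid_hcomp_vid]
  | cons p X ih =>
    have h : crossGen (b ⊗ c) p = hcomp (crossGen b p) (crossGen c p)
        ((crossGen_spec b p).2.2.2.trans (crossGen_spec c p).2.2.1.symm) := by
      obtain ⟨a, _ | _⟩ := p
      · exact crossLtr_tensor b c a
      · exact crossRtl_tensor b c a
    simp only [cross_cons, h, ih]
    rw [interchange]

/-! ### Cells slide past crossing wires -/

theorem cross_ltr (c a : A) : cross c [(a, .ltr)] = crossLtr c a := by
  simp only [cross_cons, cross_nil, vcomp_vid]; rfl

theorem cross_rtl (c a : A) : cross c [(a, .rtl)] = crossRtl c a := by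
  simp only [cross_cons, cross_nil, vcomp_vid]; rfl

/-- Crossings are natural in cells: a cell `x` can be pulled through a wire `c` that passes from
its left to its right. If the wire passes above `x`, it crosses the exchanges on the right boundary
of `x`, and if it passes below `x`, it crosses those on the left boundary. -/
theorem slides_swap (c : A) (x : Cell A) :
    Slides (swap c x.top) (hcomp x (cross c x.right) (by simp))
      (hcomp (cross c x.left) x (by simp)) (swap c x.bottom) := by
  induction x using induction with
  | @vert a b f =>
    simp only [top_vert, bottom_vert, left_vert, right_vert, cross_nil]
    rw [← vert_whiskerRight, ← vert_whiskerLeft]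
    exact .vert (BraidedCategory.braiding_naturality_right _ _).symm
  | vid a =>
    simp only [top_vid, bottom_vid, left_vid, right_vid, cross_nil, vid_hcomp_vid]
    exact .vid_of rfl rfl
  | hid X =>
    simp only [top_hid, bottom_hid, left_hid, right_hid, hid_hcomp, hcomp_hid,
      swap_tensorUnit_right]
    exact .of_vid _ (by simp) (by simp)
  | outRight a =>
    simp only [top_outRight, bottom_outRight, left_outRight, right_outRight, cross_ltr, cross_nil,
      outRight_hcomp_crossLtr, swap_tensorUnit_right]
    refine ⟨by simp, by simp [StrictMonoidal.tensor_unit], ?_⟩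
    rw [← vcomp_assoc _ _ _ (by simp) (by simp)]
    simp only [swap_symm, vid_vcomp, vcomp_vid]
  | inLeft a =>
    simp only [top_inLeft, bottom_inLeft, left_inLeft, right_inLeft, cross_ltr, cross_nil,
      crossLtr_hcomp_inLeft, swap_tensorUnit_right]
    refine ⟨by simp [StrictMonoidal.unit_tensor], by simp, ?_⟩
    simp only [vcomp_assoc', swap_symm, vid_vcomp, vcomp_vid]
  | outLeft a =>
    simp only [top_outLeft, bottom_outLeft, left_outLeft, right_outLeft, cross_rtl, cross_nil,
      crossRtl_hcomp_outLeft, swap_tensorUnit_right]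
    exact ⟨by simp, by simp [StrictMonoidal.unit_tensor], by simp only [vcomp_vid]⟩
  | inRight a =>
    simp only [top_inRight, bottom_inRight, left_inRight, right_inRight, cross_rtl, cross_nil,
      inRight_hcomp_crossRtl, swap_tensorUnit_right]
    exact ⟨by simp [StrictMonoidal.tensor_unit], by simp, by simp only [vid_vcomp]⟩
  | hcomp x y h hx hy =>
    simp only [top_hcomp, bottom_hcomp, left_hcomp, right_hcomp, swap_tensor_right]
    -- By the hexagon identity, `c` passes first `x` and then `y`; in between, it crosses the common
    -- boundary of the two.
    have h₁ := hx.hcomp (.of_vid y rfl rfl) (by simp) (by simp [h]) (by simp [h]) (by simp)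
    have h₂ := (Slides.of_vid x rfl rfl).hcomp hy (by simp) (by simp [h]) (by simp [h]) (by simp)
    simp only [hcomp_assoc'] at h₁ h₂ ⊢
    simp only [h] at h₁
    exact h₂.trans h₁ _ _
  | vcomp x y h hx hy =>
    simp only [top_vcomp, bottom_vcomp, left_vcomp, right_vcomp, cross_append]
    rw [interchange _ _ _ _ h (by simp) (by simp) (by simp),
      interchange _ _ _ _ (by simp) h (by simp) (by simp)]
    rw [← h] at hy
    exact hx.vcomp hy _ _

/-- `Cell.slides_swap` for a wire that passes from the right of the cell to its left. -/
theorem slides_swap' (c : A) (x : Cell A) :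
    Slides (swap x.top c) (hcomp (cross c x.left) x (by simp))
      (hcomp x (cross c x.right) (by simp)) (swap x.bottom c) := by
  have := Slides.inv (f := β_ c x.top) (g := β_ c x.bottom) (slides_swap c x) (by simp) (by simp)
  simp only [← SymmetricCategory.braiding_swap_eq_inv_braiding] at this
  exact this

/-! ### The tensor product of cells -/

theorem tensor_eq (x y : Cell A) : tensor x y =
    vcomp (hcomp x (cross y.top x.right) (by simp)) (hcomp (cross x.bottom y.left) y (by simp))
      (by simp) := (rfl)

theorem hid_tensor_hid (X Y : Exchange A) : tensor (hid X) (hid Y) = hid (X ++ Y) := by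
  simp only [tensor, top_hid, bottom_hid, left_hid, cross_tensorUnit, hcomp_hid, hid_vcomp_hid]

theorem hid_nil_tensor (x : Cell A) : tensor (hid []) x = x := by
  simp only [tensor_eq, right_hid, bottom_hid, cross_tensorUnit, cross_nil, hid_hcomp,
    vid_vcomp]

theorem tensor_hid_nil (x : Cell A) : tensor x (hid []) = x := by
  simp only [tensor_eq, top_hid, left_hid, cross_tensorUnit, cross_nil, hcomp_hid,
    vcomp_vid]

theorem tensor_assoc (x y z : Cell A) : tensor (tensor x y) z = tensor x (tensor y z) := by
  simp only [tensor_eq, top_vcomp, top_hcomp, bottom_vcomp, bottom_hcomp, left_vcomp, left_hcomp,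
    right_vcomp, right_hcomp, top_cross, bottom_cross, left_cross, right_cross, cross_append,
    cross_tensor, interchange, vcomp_assoc', hcomp_assoc']

/-- The tensor product of cells is compatible with horizontal composition up to the symmetry that
exchanges the two inner wires. -/
theorem slides_tensor_hcomp (x y x' y' : Cell A) (h : x.right = y.left) (h' : x'.right = y'.left) :
    Slides (hcomp (hcomp (vid x.top) (swap x'.top y.top) (by simp)) (vid y'.top) (by simp))
      (tensor (hcomp x y h) (hcomp x' y' h'))
      (hcomp (tensor x x') (tensor y y') (by simp [h, h']))
      (hcomp (hcomp (vid x.bottom) (swap x'.bottom y.bottom) (by simp)) (vid y'.bottom)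
        (by simp)) := by
  -- In the upper row, the top wire of `x'` passes from the left of `y` to its right; in the lower
  -- row, the bottom wire of `y` passes from the right of `x'` to its left.
  have h₁ := ((Slides.of_vid x rfl rfl).hcomp (slides_swap x'.top y) (by simp) (by simp [h])
    (by simp [h]) (by simp)).hcomp (.of_vid (cross y'.top y.right) rfl rfl) (by simp) (by simp)
      (by simp) (by simp)
  have h₂ := ((Slides.of_vid (cross x.bottom x'.left) rfl rfl).hcomp (slides_swap' y.bottom x')
    (by simp) (by simp) (by simp) (by simp)).hcomp (.of_vid y' rfl rfl) (by simp) (by simp [h'])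
      (by simp [h']) (by simp)
  simp only [top_cross, bottom_cross] at h₁ h₂
  have h₃ := h₁.vcomp h₂ (by simp) (by simp)
  simp only [tensor, top_hcomp, bottom_hcomp, left_hcomp, right_hcomp, cross_tensor]
  rw [interchange _ _ _ _ (by simp) (by simp) (by simp [h]) (by simp [h'])]
  simp only [hcomp_assoc'] at h₃ ⊢
  simpa only [h, h'] using h₃

end Cell

namespace SituatedSystem

variable {A : Type u} [Category.{v} A] [MonoidalCategory A] [StrictMonoidal A]
  {U V W U' V' W' : SituatedBoundary.{s, t} A}

/-! ### Systems of graph isomorphisms -/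

theorem ofGraphIso_comp (i : RGraph.Iso U.graph V.graph) (h : i.hom.comp V.sit = U.sit)
    (j : RGraph.Iso V.graph W.graph) (k : j.hom.comp W.sit = V.sit)
    (l : (i.trans j).hom.comp W.sit = U.sit) :
    Equivalent ((ofGraphIso i h).comp (ofGraphIso j k)) (ofGraphIso (i.trans j) l) := by
  refine .of_eq (.pullbackFstIso i.hom (.refl _)) rfl ?_ (fun x => ?_) fun e => ?_
  · ext x
    · exact congrArg j.hom.onV x.2
    · exact congrArg j.hom.onE x.2
  · exact StrictMonoidal.unit_tensor (𝟙_ A)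
  · have : V.sit.onE e.1.2 = U.sit.onE e.1.1 :=
      (congrArg V.sit.onE e.2.symm).trans (congrArg (fun f => f.onE e.1.1) h)
    exact (Cell.hcomp_congr (x := Cell.hid (U.sit.onE e.1.1)) rfl (congrArg Cell.hid this)
      (by simp [this])).trans (Cell.hid_hcomp _ (by simp))

/-- Isomorphisms of graphs between the boundaries of two systems are compatible with the systems as
soon as they lift to an isomorphism of the apices that preserves all objects and cells. -/
theorem comp_ofGraphIso_equivalent (R : SituatedSystem U V) (S : SituatedSystem U' V')
    (i : RGraph.Iso U.graph U'.graph) (hi : i.hom.comp U'.sit = U.sit)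
    (j : RGraph.Iso V.graph V'.graph) (hj : j.hom.comp V'.sit = V.sit)
    (a : RGraph.Iso R.apex S.apex) (hL : a.hom.comp S.legL = R.legL.comp i.hom)
    (hR : a.hom.comp S.legR = R.legR.comp j.hom) (hV : ∀ x, R.obj x = S.obj (a.hom.onV x))
    (hE : ∀ e, R.cell e = S.cell (a.hom.onE e)) :
    Equivalent (R.comp (ofGraphIso j hj)) ((ofGraphIso i hi).comp S) := by
  have hLV (x) : S.legL.onV (a.hom.onV x) = i.hom.onV (R.legL.onV x) :=
    congrArg (fun f => f.onV x) hL
  have hLE (e) : S.legL.onE (a.hom.onE e) = i.hom.onE (R.legL.onE e) :=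
    congrArg (fun f => f.onE e) hL
  have hRV (x) : S.legR.onV (a.hom.onV x) = j.hom.onV (R.legR.onV x) :=
    congrArg (fun f => f.onV x) hR
  have hRE (e) : S.legR.onE (a.hom.onE e) = j.hom.onE (R.legR.onE e) :=
    congrArg (fun f => f.onE e) hR
  refine .of_eq (((RGraph.Iso.pullbackFstIso R.legR (.refl _)).trans a).trans
    (RGraph.Iso.pullbackSndIso i S.legL).symm) ?_ ?_ (fun x => ?_) fun e => ?_
  · ext x
    · simp [hLV]
    · simp [hLE]
  · ext x
    · exact (hRV _).trans (congrArg j.hom.onV x.2)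
    · exact (hRE _).trans (congrArg j.hom.onE x.2)
  · exact (StrictMonoidal.tensor_unit (R.obj x.1.1)).trans
      ((hV _).trans (StrictMonoidal.unit_tensor (S.obj (a.hom.onV x.1.1))).symm)
  · have hU : U.sit.onE (i.inv.onE (S.legL.onE (a.hom.onE e.1.1))) =
        U'.sit.onE (S.legL.onE (a.hom.onE e.1.1)) := by
      rw [← hi]; simp
    exact (Cell.hcomp_hid (R.cell e.1.1) (X := V.sit.onE e.1.2) (by simp [e.2])).trans
      ((hE _).trans (Cell.hid_hcomp (S.cell (a.hom.onE e.1.1))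
        (X := U.sit.onE (i.inv.onE (S.legL.onE (a.hom.onE e.1.1)))) (by simp [hU])).symm)

variable [SymmetricCategory A]

theorem ofGraphIso_tensor (i : RGraph.Iso U.graph V.graph) (h : i.hom.comp V.sit = U.sit)
    (j : RGraph.Iso U'.graph V'.graph) (k : j.hom.comp V'.sit = U'.sit)
    (l : (i.prodMap j).hom.comp (V.tensor V').sit = (U.tensor U').sit) :
    Equivalent ((ofGraphIso i h).tensor (ofGraphIso j k))
      (ofGraphIso (U := U.tensor U') (V := V.tensor V') (i.prodMap j) l) :=
  .of_eq (.refl _) rfl rfl (fun _ => StrictMonoidal.unit_tensor (𝟙_ A))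
    fun e => Cell.hid_tensor_hid (U.sit.onE e.1) (U'.sit.onE e.2)

/-! ### Interchange of the tensor product with composition -/

/-- The isomorphism that exchanges the two inner factors of a tensor product of four objects. -/
def innerSwap (a b c d : A) : (a ⊗ b) ⊗ (c ⊗ d) ≅ (a ⊗ c) ⊗ (b ⊗ d) :=
  eqToIso (by simp [StrictMonoidal.tensor_assoc]) ≪≫ ((Iso.refl a ⊗ᵢ β_ b c) ⊗ᵢ Iso.refl d) ≪≫
    eqToIso (by simp [StrictMonoidal.tensor_assoc])

theorem vert_innerSwap (a b c d : A) :
    Cell.vert (innerSwap a b c d).hom =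
      Cell.hcomp (Cell.hcomp (Cell.vid a) (Cell.swap b c) (by simp)) (Cell.vid d) (by simp) := by
  simp only [innerSwap, Iso.trans_hom, eqToIso.hom, Cell.vert_eqToHom_comp_eq,
    Cell.vert_comp_eqToHom, tensorIso_hom, Iso.refl_hom, Cell.vert_tensor, Cell.vert_id]
  rfl

/-- The tensor product preserves composition of systems up to coherent isomorphism; the isomorphism
of situations is `innerSwap`. -/
theorem tensor_comp_tensor (R : SituatedSystem U V) (S : SituatedSystem V W)
    (R' : SituatedSystem U' V') (S' : SituatedSystem V' W') :
    Equivalent ((R.tensor R').comp (S.tensor S')) ((R.comp S).tensor (R'.comp S')) := by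
  refine .mk'
    { hom := ⟨fun x => (⟨(x.1.1.1, x.1.2.1), congrArg Prod.fst x.2⟩,
          ⟨(x.1.1.2, x.1.2.2), congrArg Prod.snd x.2⟩),
        fun x => (⟨(x.1.1.1, x.1.2.1), congrArg Prod.fst x.2⟩,
          ⟨(x.1.1.2, x.1.2.2), congrArg Prod.snd x.2⟩),
        fun _ => rfl, fun _ => rfl, fun _ => rfl⟩
      inv := ⟨fun x => ⟨((x.1.1.1, x.2.1.1), (x.1.1.2, x.2.1.2)), Prod.ext x.1.2 x.2.2⟩,
        fun x => ⟨((x.1.1.1, x.2.1.1), (x.1.1.2, x.2.1.2)), Prod.ext x.1.2 x.2.2⟩,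
        fun _ => rfl, fun _ => rfl, fun _ => rfl⟩
      hom_inv := rfl
      inv_hom := rfl } rfl rfl
    (fun x => innerSwap (R.obj x.1.1.1) (R'.obj x.1.1.2) (S.obj x.1.2.1) (S'.obj x.1.2.2))
    fun e => ?_
  have h := Cell.slides_tensor_hcomp (R.cell e.1.1.1) (S.cell e.1.2.1) (R'.cell e.1.1.2)
    (S'.cell e.1.2.2)
    (by rw [right_cell, left_cell]; exact congrArg (fun x => V.sit.onE x.1) e.2)
    (by rw [right_cell, left_cell]; exact congrArg (fun x => V'.sit.onE x.2) e.2)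
  simp only [top_cell, bottom_cell, ← vert_innerSwap] at h
  exact h

end SituatedSystem

namespace SituatedBoundary

variable {A : Type u} [Category.{v} A] [MonoidalCategory A] [StrictMonoidal A]
  {U V W U' V' W' : SituatedBoundary.{s, t} A}

/-! ### The monoidal category -/

theorem isoOfGraphIso_comp (i : RGraph.Iso U.graph V.graph) (h : i.hom.comp V.sit = U.sit)
    (j : RGraph.Iso V.graph W.graph) (k : j.hom.comp W.sit = V.sit) :
    (isoOfGraphIso i h).hom ≫ (isoOfGraphIso j k).hom =
      (isoOfGraphIso (i.trans j) (by rw [← h, ← k])).hom :=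
  (homMk_eq_iff _ _).2 (SituatedSystem.ofGraphIso_comp i h j k _)

theorem id_eq_isoOfGraphIso (U : SituatedBoundary.{s, t} A) :
    𝟙 U = (isoOfGraphIso (U := U) (V := U) (.refl U.graph) rfl).hom := rfl

variable [SymmetricCategory A]

theorem isoOfGraphIso_tensor (i : RGraph.Iso U.graph V.graph) (h : i.hom.comp V.sit = U.sit)
    (j : RGraph.Iso U'.graph V'.graph) (k : j.hom.comp V'.sit = U'.sit) :
    tensorHom (isoOfGraphIso i h).hom (isoOfGraphIso j k).hom =
      (isoOfGraphIso (U := U.tensor U') (V := V.tensor V') (i.prodMap j)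
        (exchangeGraph_hom_ext fun e => congrArg₂ (· ++ ·) (congrArg (fun f => f.onE e.1) h)
          (congrArg (fun f => f.onE e.2) k))).hom :=
  (homMk_eq_iff _ _).2 (SituatedSystem.ofGraphIso_tensor i h j k _)

theorem tensorHom_id_id (U V : SituatedBoundary.{s, t} A) :
    tensorHom (𝟙 U) (𝟙 V) = 𝟙 (U.tensor V) := by
  simp only [id_eq_isoOfGraphIso]
  exact isoOfGraphIso_tensor _ _ _ _

theorem pentagon (U V W Z : SituatedBoundary.{s, t} A) :
    tensorHom ((monoidalStruct A).associator U V W).hom (𝟙 Z) ≫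
        ((monoidalStruct A).associator U (V.tensor W) Z).hom ≫
          tensorHom (𝟙 U) ((monoidalStruct A).associator V W Z).hom =
      ((monoidalStruct A).associator (U.tensor V) W Z).hom ≫
        ((monoidalStruct A).associator U V (W.tensor Z)).hom := by
  rw [id_eq_isoOfGraphIso, id_eq_isoOfGraphIso]
  -- Both sides become the isomorphism of the same isomorphism of graphs.
  erw [isoOfGraphIso_tensor, isoOfGraphIso_tensor, isoOfGraphIso_comp, isoOfGraphIso_comp,
    isoOfGraphIso_comp]
  rfl

theorem triangle (U V : SituatedBoundary.{s, t} A) :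
    ((monoidalStruct A).associator U (unit A) V).hom ≫
        tensorHom (𝟙 U) ((monoidalStruct A).leftUnitor V).hom =
      tensorHom ((monoidalStruct A).rightUnitor U).hom (𝟙 V) := by
  rw [id_eq_isoOfGraphIso, id_eq_isoOfGraphIso]
  erw [isoOfGraphIso_tensor, isoOfGraphIso_tensor, isoOfGraphIso_comp]
  rfl

theorem tensorHom_comp (f : U ⟶ V) (f' : U' ⟶ V') (g : V ⟶ W) (g' : V' ⟶ W') :
    tensorHom f f' ≫ tensorHom g g' = tensorHom (f ≫ g) (f' ≫ g') := by
  obtain ⟨R⟩ := f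
  obtain ⟨R'⟩ := f'
  obtain ⟨S⟩ := g
  obtain ⟨S'⟩ := g'
  exact (homMk_eq_iff _ _).2 (SituatedSystem.tensor_comp_tensor R S R' S')

end SituatedBoundary

theorem proposition3p3 (A : Type u) [Category.{v} A] [MonoidalCategory A] [SymmetricCategory A]
    [StrictMonoidal A] :
    ∃ M : MonoidalCategory (SituatedBoundary.{s, t} A),
      M.toMonoidalCategoryStruct = SituatedBoundary.monoidalStruct A := by
  let := SituatedBoundary.monoidalStruct.{s, t} A
  refine ⟨.ofTensorHom (C := SituatedBoundary.{s, t} A) SituatedBoundary.tensorHom_id_id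
    (fun _ _ _ _ => rfl) (fun _ _ => rfl) SituatedBoundary.tensorHom_comp ?_ ?_ ?_
    SituatedBoundary.pentagon SituatedBoundary.triangle, rfl⟩
  · rintro X₁ X₂ X₃ Y₁ Y₂ Y₃ ⟨R₁⟩ ⟨R₂⟩ ⟨R₃⟩
    exact (SituatedBoundary.homMk_eq_iff _ _).2 <|
      SituatedSystem.comp_ofGraphIso_equivalent ((R₁.tensor R₂).tensor R₃)
        (R₁.tensor (R₂.tensor R₃)) _ _ _ _
        (.prodAssoc R₁.apex R₂.apex R₃.apex) rfl rfl
        (fun x => StrictMonoidal.tensor_assoc (R₁.obj x.1.1) (R₂.obj x.1.2) (R₃.obj x.2))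
        (fun e => Cell.tensor_assoc (R₁.cell e.1.1) (R₂.cell e.1.2) (R₃.cell e.2))
  · rintro X Y ⟨R⟩
    exact (SituatedBoundary.homMk_eq_iff _ _).2 <|
      SituatedSystem.comp_ofGraphIso_equivalent
        ((SituatedSystem.id (SituatedBoundary.unit A)).tensor R) R _ _ _ _
        (.pointProd R.apex) rfl rfl (fun x => StrictMonoidal.unit_tensor (R.obj x.2))
        (fun e => Cell.hid_nil_tensor (R.cell e.2))
  · rintro X Y ⟨R⟩
    exact (SituatedBoundary.homMk_eq_iff _ _).2 <|
      SituatedSystem.comp_ofGraphIso_equivalent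
        (R.tensor (SituatedSystem.id (SituatedBoundary.unit A))) R _ _ _ _
        (.prodPoint R.apex) rfl rfl (fun x => StrictMonoidal.tensor_unit (R.obj x.1))
        (fun e => Cell.tensor_hid_nil (R.cell e.1))
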